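/- Theorem (cyclic polytopes). Let $d \ge 1$ and $n \ge d+1$. Let $C_d(n)$ be the cyclic polytope, that is, the convex hull in $\mathbb{R}^d$ of $n$ points $\gamma(t_1),\dots,\gamma(t_n)$ with $t_1<\dots<t_n$ on the moment curve $\gamma(t)=(t,t^2,\dots,t^d)$, and let $c$ be a point in its interior. Then its polar dual $$P=\{y\in\mathbb{R}^d : \langle x-c,\,y\rangle\le 1 \text{ for all } x\in C_d(n)\}$$ is a simple $d$-polytope, and it satisfies Perles' conjecture: every induced, connected, $(d-1)$-regular, non-separating subgraph $H$ of the graph $G(P)$ is the graph $G(F)$ of a facet $F$ of $P$. Here $G(P)$ is the graph formed by the vertices and edges of $P$, and $H$ is non-separating if removing its vertices from $G(P)$ does not leave a disconnected graph. -/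

import Mathlib

/-- The moment curve `x ↦ (x, x², …, x^d)` in `ℝ^d`. -/
noncomputable def momentCurve (d : ℕ) (x : ℝ) : EuclideanSpace ℝ (Fin d) :=
  WithLp.toLp 2 (fun i : Fin d => x ^ ((i : ℕ) + 1))

/-- The cyclic polytope `C_d(n)`, realized as the convex hull of the `n` points with
parameters `t 0 < t 1 < … < t (n - 1)` on the moment curve. -/
noncomputable def cyclicPolytope (d : ℕ) {n : ℕ} (t : Fin n → ℝ) :
    Set (EuclideanSpace ℝ (Fin d)) :=
  convexHull ℝ (Set.range (fun i => momentCurve d (t i)))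

section Polytopes

variable {E : Type*} [NormedAddCommGroup E] [InnerProductSpace ℝ E]

/-- The polar dual of `P` with respect to the point `c` as origin
(`c` is to be an interior point of `P`). -/
def polarDual (P : Set E) (c : E) : Set E :=
  {y | ∀ x ∈ P, inner ℝ (x - c) y ≤ 1}

/-- `v` and `w` are the two end points of an edge (a one-dimensional face) of `P`. -/
def IsPolytopeEdge (P : Set E) (v w : E) : Prop :=
  v ∈ P.extremePoints ℝ ∧ w ∈ P.extremePoints ℝ ∧ v ≠ w ∧ IsExposed ℝ P (segment ℝ v w)

/-- The graph `G(P)`: the nodes are the vertices (extreme points) of `P`,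
and adjacency is given by the edges of `P`. -/
def polytopeGraph (P : Set E) : SimpleGraph (P.extremePoints ℝ) where
  Adj v w := IsPolytopeEdge P v w
  symm := ⟨fun v w h => ⟨h.2.1, h.1, h.2.2.1.symm, by
    have := h.2.2.2
    rwa [segment_symm] at this⟩⟩
  loopless := ⟨fun _ h => h.2.2.1 rfl⟩

/-- `F` is a facet of `P`: a nonempty face of codimension one. -/
def IsPolytopeFacet (P F : Set E) : Prop :=
  IsExposed ℝ P F ∧ F.Nonempty ∧
    Module.finrank ℝ (vectorSpan ℝ F) + 1 = Module.finrank ℝ (vectorSpan ℝ P)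

/-- `P` is a simple `d`-polytope: the convex hull of a nonempty finite set of points, of
dimension `d`, such that every vertex lies on exactly `d` edges. -/
structure IsSimplePolytope (d : ℕ) (P : Set E) : Prop where
  exists_finite : ∃ S : Set E, S.Finite ∧ S.Nonempty ∧ P = convexHull ℝ S
  dim_eq : Module.finrank ℝ (vectorSpan ℝ P) = d
  degree_eq : ∀ v, ((polytopeGraph P).neighborSet v).encard = d

/-- The subgraph `H` of `G(P)` is the graph `G(F)` of `F` (a facet of `P`): its nodes are the
vertices of `F`, and its edges are the edges of `F`. -/
def IsGraphOf {P : Set E} (H : (polytopeGraph P).Subgraph) (F : Set E) : Prop :=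
  Subtype.val '' H.verts = F.extremePoints ℝ ∧
    ∀ v w, H.Adj v w ↔ IsPolytopeEdge F (v : E) (w : E)

/-- `H` is non-separating: any two nodes of `G` outside `H` are joined by a path of `G`
that avoids `H`. -/
def IsNonSeparating {V : Type*} {G : SimpleGraph V} (H : G.Subgraph) : Prop :=
  (G.induce H.vertsᶜ).Preconnected

/-- `P` is a simple `d`-polytope that satisfies Perles' conjecture: every induced, connected,
`(d - 1)`-regular, non-separating subgraph of `G(P)` is the graph of a facet of `P`. -/
def SatisfiesPerlesConjecture (d : ℕ) (P : Set E) : Prop :=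
  IsSimplePolytope d P ∧
    ∀ H : (polytopeGraph P).Subgraph,
      H.IsInduced → H.Connected →
      (∀ v ∈ H.verts, (H.neighborSet v).encard + 1 = d) →
      IsNonSeparating H →
      ∃ F : Set E, IsPolytopeFacet P F ∧ IsGraphOf H F

end Polytopes

/-! The vertices of `P` correspond to the facets of the cyclic polytope, which are the `d`-sets
satisfying Gale's evenness condition, and the edges of `P` to pairs of facets sharing `d - 1`
points. An induced `(d - 1)`-regular `H` becomes a family of facets, each with exactly one neighbour
outside (`IsPerlesFamily`). It suffices to find a point `i` that lies in a member of `H` and in no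
facet outside `H`: connectedness then makes `H` the star of `i`, which is a facet of `P`
(`IsPerlesFamily.exists_eq_star`).

To find `i`, put `n = d + N` and unroll the complement of a facet periodically to `ℤ`. The result is
an increasing sequence of holes with alternating colours (`IsHoleSeq`); for odd `d` the colouring of
`ℤ` has a defect, the seam, before each multiple of `n`. Adjacent facets differ by moving one hole,
with its translates, between its two neighbours (`IsHoleSeq.exists_lift`). The hole sequences of a
fixed phase form a lattice under pointwise maximum and minimum. Let `W` be the sequences of facets
outside `H`; a sequence not in `W` has at most one neighbour in `W`. Hence if two holes can be
raised separately within `W`, they can be raised together. So walks in `W` have common ascending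
continuations (`UniqueExit.exists_join`), and a hole whose raising leads into `H` stays blocked
along them: no walk in `W` raises it (`UniqueExit.apply_le`).

That the blocked hole `s` cannot be lowered either comes from periodicity
(`UniqueExit.apply_eq_of_lt`). Keep `s` fixed and blocked, and push the holes above it down as far
as `W` permits. If there is slack, some hole is blocked from below; then so are all the following
ones up to `s + N`, a translate of `s`. A packed sequence uses one off-seam position per hole, `N`
out of `d + N - 1` in a period, so there is slack as soon as the raising move uses fewer than `d -
1`. A shortest move uses at most two, which suffices for `d ≥ 4`; a move by one position across the
seam uses none, which suffices for `d ≥ 2`. As `H` is non-separating, every facet outside `H` is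
reached by a walk, so all of them have the frozen hole in common, and it is the required `i`.

The cases `d ≤ 2` and `n = d + 1` are direct. For `d = 3` the facets come in pairs joined by a seam
move: either the boundary of `H` separates such a pair, or `H` respects the pairs and a full star is
visible. The geometric side rests on the fact that affine functions on the moment curve are
polynomials of degree at most `d`. -/

open Filter Topology

/-! ### Walks in a lattice of functions with unique exits -/

section LatticeWalks

variable {ι α : Type*}

/-- `x` and `y` agree outside the class of `s`. -/
def AgreeOff (r : Setoid ι) (s : ι) (x y : ι → α) : Prop :=
  ∀ u, ¬ r s u → x u = y u

/-- One step of a walk inside `W`. -/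
def WStep (r : Setoid ι) (W : Set (ι → α)) (x y : ι → α) : Prop :=
  x ∈ W ∧ y ∈ W ∧ ∃ s, AgreeOff r s x y

lemma AgreeOff.symm {r : Setoid ι} {s : ι} {x y : ι → α} (h : AgreeOff r s x y) :
    AgreeOff r s y x := fun u hu => (h u hu).symm

lemma AgreeOff.trans {r : Setoid ι} {s : ι} {x y z : ι → α} (h : AgreeOff r s x y)
    (h' : AgreeOff r s y z) : AgreeOff r s x z := fun u hu => (h u hu).trans (h' u hu)

lemma WStep.symm {r : Setoid ι} {W : Set (ι → α)} {x y : ι → α} (h : WStep r W x y) :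
    WStep r W y x := ⟨h.2.1, h.1, h.2.2.imp fun _ hs => hs.symm⟩

variable [LinearOrder α]

/-- A set of functions, closed under pointwise minimum and maximum, in which the order of two
values is constant along each class, together with a subset `W` such that every member outside
`W` has at most one neighbour in `W`. -/
structure UniqueExit (r : Setoid ι) (C W : Set (ι → α)) : Prop where
  sup_mem : ∀ x ∈ C, ∀ y ∈ C, x ⊔ y ∈ C
  inf_mem : ∀ x ∈ C, ∀ y ∈ C, x ⊓ y ∈ C
  le_of_le : ∀ x ∈ C, ∀ y ∈ C, ∀ s u, r s u → x s ≤ y s → x u ≤ y u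
  subset : W ⊆ C
  unique : ∀ g ∈ C, g ∉ W → ∀ x ∈ W, ∀ y ∈ W, ∀ s s',
    AgreeOff r s g x → AgreeOff r s' g y → x = y

variable {r : Setoid ι} {C W : Set (ι → α)}

lemma UniqueExit.le_of_agreeOff (h : UniqueExit r C W) {x y : ι → α} (hx : x ∈ C) (hy : y ∈ C)
    {s : ι} (hxy : AgreeOff r s x y) (hs : x s ≤ y s) : x ≤ y := by
  intro u
  by_cases hu : r s u
  · exact h.le_of_le x hx y hy s u hu hs
  · exact (hxy u hu).le

/-- The axioms are invariant under reversal of the order, so statements about raising a coordinate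
also give statements about lowering it. -/
lemma UniqueExit.dual (h : UniqueExit r C W) :
    UniqueExit (α := αᵒᵈ) r C W where
  sup_mem := h.inf_mem
  inf_mem := h.sup_mem
  le_of_le x hx y hy s u hr hs := h.le_of_le y hy x hx s u hr hs
  subset := h.subset
  unique := h.unique

/-- Two members of `W` joined by a walk in `W` have a common upper bound that is reached from both
by ascending walks in `W`. -/
lemma UniqueExit.exists_join (h : UniqueExit r C W) {x y : ι → α}
    (hxy : Relation.ReflTransGen (WStep r W) x y) :
    ∃ w, Relation.ReflTransGen (fun a b => WStep r W a b ∧ a ≤ b) x w ∧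
      Relation.ReflTransGen (fun a b => WStep r W a b ∧ a ≤ b) y w := by
  set R : (ι → α) → (ι → α) → Prop := fun a b => WStep r W a b ∧ a ≤ b with hR
  -- Local confluence. If different classes were raised, `a ⊔ b` performs both moves and has `a` and
  -- `b` as neighbours; outside `W` it would force `a = b`, whence `a ⊔ b = a ∈ W`. Church–Rosser
  -- then gives the global statement.
  have hcr : ∀ a b c, R a b → R a c →
      ∃ e, Relation.ReflGen R b e ∧ Relation.ReflTransGen R c e := by
    rintro z a b ⟨⟨hz, ha, s, hs⟩, hza⟩ ⟨⟨-, hb, s', hs'⟩, hzb⟩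
    by_cases hss : r s s'
    · have hab : AgreeOff r s a b := fun u hu =>
        (hs u hu).symm.trans (hs' u fun h' => hu (r.trans hss h'))
      rcases le_total (a s) (b s) with hle | hle
      · exact ⟨b, .single ⟨⟨ha, hb, s, hab⟩,
          h.le_of_agreeOff (h.subset ha) (h.subset hb) hab hle⟩, .refl⟩
      · exact ⟨a, .refl, .single ⟨⟨hb, ha, s, hab.symm⟩,
          h.le_of_agreeOff (h.subset hb) (h.subset ha) hab.symm hle⟩⟩
    · have h1 : AgreeOff r s' a (a ⊔ b) := fun u hu => by
        have : b u = z u := (hs' u hu).symm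
        simp only [Pi.sup_apply, this]
        exact (sup_eq_left.2 (hza u)).symm
      have h2 : AgreeOff r s b (a ⊔ b) := fun u hu => by
        have : a u = z u := (hs u hu).symm
        simp only [Pi.sup_apply, this]
        exact (sup_eq_right.2 (hzb u)).symm
      have hC : a ⊔ b ∈ C := h.sup_mem _ (h.subset ha) _ (h.subset hb)
      have hW : a ⊔ b ∈ W := by
        by_contra hW
        have hab := h.unique _ hC hW a ha b hb s' s h1.symm h2.symm
        exact hW (by rw [← hab, sup_idem]; exact ha)
      exact ⟨a ⊔ b, .single ⟨⟨ha, hW, s', h1⟩, le_sup_left⟩,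
        .single ⟨⟨hb, hW, s, h2⟩, le_sup_right⟩⟩
  have heq := Relation.equivalence_join_reflTransGen hcr
  have : Relation.Join (Relation.ReflTransGen R) x y := by
    induction hxy with
    | refl => exact heq.refl x
    | @tail b c _ hbc ih =>
      refine heq.trans ih ?_
      obtain ⟨hb, hc, s, hs⟩ := hbc
      rcases le_total (b s) (c s) with hle | hle
      · exact ⟨c, .single ⟨⟨hb, hc, s, hs⟩,
          h.le_of_agreeOff (h.subset hb) (h.subset hc) hs hle⟩, .refl⟩
      · exact ⟨b, .refl, .single ⟨⟨hc, hb, s, hs.symm⟩,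
          h.le_of_agreeOff (h.subset hc) (h.subset hb) hs.symm hle⟩⟩
  exact this

/-- If raising the coordinate `s` of `z ∈ W` once leads out of `W`, then no walk in `W`
from `z` can raise the coordinate `s`. -/
lemma UniqueExit.apply_le (h : UniqueExit r C W) {z g y : ι → α} (hz : z ∈ W) (hg : g ∈ C)
    (hgW : g ∉ W) {s : ι} (hzg : AgreeOff r s z g) (hlt : z s < g s)
    (hy : Relation.ReflTransGen (WStep r W) z y) : y s ≤ z s := by
  obtain ⟨w, hzw, hyw⟩ := h.exists_join hy
  have hle : y ≤ w := by
    clear hzw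
    induction hyw with
    | refl => exact le_rfl
    | tail _ hbc ih => exact ih.trans hbc.2
  -- Invariant along the ascending walk from `z`: the coordinate `s` is unchanged, and raising it to
  -- the value `g s` still leads out of `W`.
  have key : w ∈ W ∧ w s = z s ∧ ∃ g' ∈ C, g' ∉ W ∧ AgreeOff r s w g' ∧ g' s = g s := by
    clear hyw hle
    induction hzw with
    | refl => exact ⟨hz, rfl, g, hg, hgW, hzg, rfl⟩
    | @tail b c _ hbc ih =>
      obtain ⟨hb, hbs, g', hg', hg'W, hbg, hgs⟩ := ih
      obtain ⟨⟨-, hc, u, hu⟩, hbc'⟩ := hbc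
      by_cases hsu : r s u
      · have hbc2 : AgreeOff r s b c := fun v hv => hu v fun h' => hv (r.trans hsu h')
        have := h.unique g' hg' hg'W b hb c hc s s hbg.symm (hbg.symm.trans hbc2)
        subst this
        exact ⟨hb, hbs, g', hg', hg'W, hbg, hgs⟩
      · have hcs : c s = z s := by
          rw [← hbs]; exact (hu s fun h' => hsu (r.symm h')).symm
        have hC : c ⊔ g' ∈ C := h.sup_mem _ (h.subset hc) _ hg'
        have h1 : AgreeOff r s c (c ⊔ g') := fun v hv => by
          have : g' v = b v := (hbg v hv).symm
          simp only [Pi.sup_apply, this]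
          exact (sup_eq_left.2 (hbc' v)).symm
        have hbg' : b ≤ g' := h.le_of_agreeOff (h.subset hb) hg' hbg (by rw [hbs, hgs]; exact hlt.le)
        have h2 : AgreeOff r u g' (c ⊔ g') := fun v hv => by
          have : c v = b v := (hu v hv).symm
          simp only [Pi.sup_apply, this]
          exact (sup_eq_right.2 (hbg' v)).symm
        have hgs' : (c ⊔ g') s = g s := by
          simp only [Pi.sup_apply, hcs, hgs]; exact sup_eq_right.2 hlt.le
        -- If `c ⊔ g'` were in `W`, then `g'` would have the two neighbours `b` and `c ⊔ g'` in `W`,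
        -- which differ at `s`.
        refine ⟨hc, hcs, c ⊔ g', hC, fun hW => ?_, h1, hgs'⟩
        have := h.unique g' hg' hg'W b hb _ hW s u hbg.symm h2
        have h3 : b s = g s := by rw [this]; exact hgs'
        rw [hbs] at h3
        exact hlt.ne h3
  exact (hle s).trans key.2.1.le

lemma UniqueExit.le_apply (h : UniqueExit r C W) {z g y : ι → α} (hz : z ∈ W) (hg : g ∈ C)
    (hgW : g ∉ W) {s : ι} (hzg : AgreeOff r s z g) (hlt : g s < z s)
    (hy : Relation.ReflTransGen (WStep r W) z y) : z s ≤ y s :=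
  UniqueExit.apply_le (α := αᵒᵈ) h.dual hz hg hgW hzg hlt hy

end LatticeWalks

/-! ### Periodic hole sequences and the freezing of a blocked hole -/

section HoleSequences

/-- Congruence modulo `N`, as a setoid on `ℤ`. -/
def congrSetoid (N : ℕ) : Setoid ℤ where
  r s u := (N : ℤ) ∣ u - s
  iseqv := ⟨fun s => by simp, fun {s u} h => by rw [← neg_sub]; exact h.neg_right,
    fun {s u v} h h' => by have := h'.add h; rwa [sub_add_sub_cancel] at this⟩

lemma congrSetoid_iff {N : ℕ} {s u : ℤ} : congrSetoid N s u ↔ (N : ℤ) ∣ u - s := Iff.rfl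

/-- The position of `a`, corrected by `d` for each full turn, so that its parity is the colour
that alternates along the complement of a facet of the cyclic polytope. -/
def colourPos (d N : ℕ) (a : ℤ) : ℤ := a + d * (a / (d + N))

/-- The position of `a`, not counting the multiples of the period. -/
def offSeamPos (d N : ℕ) (a : ℤ) : ℤ := a - a / (d + N)

/-- Modulo 2 the colour changes by `k * N`, exactly as the index of a hole does under `k` periods;
this makes alternation compatible with periodicity. -/
lemma colourPos_add_mul {d N : ℕ} (h : 0 < d + N) (a k : ℤ) :
    colourPos d N (a + k * (d + N)) = colourPos d N a + k * N + 2 * (k * d) := by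
  have : ((d : ℤ) + N) ≠ 0 := by omega
  simp only [colourPos, Int.add_mul_ediv_right _ _ this]
  ring

lemma offSeamPos_add {d N : ℕ} (h : 0 < d + N) (a : ℤ) :
    offSeamPos d N (a + (d + N)) = offSeamPos d N a + (d + N) - 1 := by
  have : ((d : ℤ) + N) ≠ 0 := by omega
  have h1 := Int.add_mul_ediv_right a 1 this
  rw [one_mul] at h1
  simp only [offSeamPos, h1]
  ring

/-- The step onto a multiple of the period is the seam: it changes the colour by `1 + d`, hence
preserves it for odd `d`, and costs no off-seam position. -/
lemma pos_succ {d N : ℕ} (h : 0 < d + N) (a : ℤ) :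
    ((d + N : ℤ) ∣ a + 1 ∧ colourPos d N (a + 1) = colourPos d N a + 1 + d ∧
      offSeamPos d N (a + 1) = offSeamPos d N a) ∨
    (¬ (d + N : ℤ) ∣ a + 1 ∧ colourPos d N (a + 1) = colourPos d N a + 1 ∧
      offSeamPos d N (a + 1) = offSeamPos d N a + 1) := by
  have hn : (0 : ℤ) < (d : ℤ) + N := by exact_mod_cast h
  simp only [colourPos, offSeamPos]
  set n : ℤ := (d : ℤ) + N
  have e1 := Int.emod_add_mul_ediv a n
  have b1 := Int.emod_nonneg a hn.ne'
  have b2 := Int.emod_lt_of_pos a hn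
  by_cases hs : a % n + 1 = n
  · left
    have hd : (a + 1) / n = a / n + 1 := by
      rw [show a + 1 = 0 + (a / n + 1) * n by linarith, Int.add_mul_ediv_right _ _ hn.ne']; simp
    refine ⟨⟨a / n + 1, by linarith⟩, ?_, ?_⟩ <;> rw [hd] <;> ring
  · right
    have hd : (a + 1) / n = a / n := by
      rw [show a + 1 = (a % n + 1) + (a / n) * n by linarith, Int.add_mul_ediv_right _ _ hn.ne',
        Int.ediv_eq_zero_of_lt (by omega) (by omega)]; simp
    refine ⟨fun hdvd => ?_, ?_, ?_⟩
    · have : n ∣ a % n + 1 := by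
        have h2 : a % n + 1 = (a + 1) - n * (a / n) := by linarith
        rw [h2]; exact dvd_sub hdvd (dvd_mul_right _ _)
      exact hs (le_antisymm (by omega) (Int.le_of_dvd (by omega) this))
    · rw [hd]; ring
    · rw [hd]; ring

/-- All positions strictly between `x` and `y` must have the colour of `x`. Away from the seam
colours alternate, so either `y = x + 1`, or `y = x + 2` with the seam step first, and that step is
not counted. -/
lemma offSeamPos_le_of_no_between {d N : ℕ} (h : 2 ≤ d + N) {x y : ℤ} (hxy : x < y)
    (hpar : (colourPos d N y + colourPos d N x) % 2 = 1)
    (hno : ∀ q, x < q → q < y → (colourPos d N q + colourPos d N y) % 2 = 1) :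
    offSeamPos d N y ≤ offSeamPos d N x + 1 := by
  have h1 := pos_succ (d := d) (N := N) (by omega) x
  have h2 := pos_succ (d := d) (N := N) (by omega) (x + 1)
  rcases (by omega : y = x + 1 ∨ x + 1 < y) with rfl | hlt
  · omega
  have h3 := hno (x + 1) (by omega) hlt
  have hs : (d + N : ℤ) ∣ x + 1 := by
    by_contra hs
    have := h1.resolve_left fun h => hs h.1
    omega
  have hs2 : ¬ (d + N : ℤ) ∣ x + 1 + 1 := by
    intro hs2
    have h4 := dvd_sub hs2 hs
    have := Int.le_of_dvd (by omega) h4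
    omega
  have h1' := h1.resolve_right fun h => h.1 hs
  have h2' := h2.resolve_left fun h => hs2 h.1
  rcases (by omega : y = x + 1 + 1 ∨ x + 1 + 1 < y) with rfl | hlt2
  · omega
  have h5 := hno (x + 1 + 1) (by omega) hlt2
  omega

/-- An increasing enumeration of the lifted complement of a facet of the cyclic polytope:
it is periodic, and its colours alternate. -/
structure IsHoleSeq (d N : ℕ) (ε : ℤ) (h : ℤ → ℤ) : Prop where
  lt_succ : ∀ t, h t < h (t + 1)
  add_period : ∀ t, h (t + N) = h t + (d + N)
  parity : ∀ t, (colourPos d N (h t) + t + ε) % 2 = 0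

variable {d N : ℕ} {ε : ℤ}

lemma IsHoleSeq.strictMono {h : ℤ → ℤ} (hh : IsHoleSeq d N ε h) : StrictMono h :=
  strictMono_int_of_lt_succ hh.lt_succ

lemma IsHoleSeq.add_mul_period {h : ℤ → ℤ} (hh : IsHoleSeq d N ε h) (t k : ℤ) :
    h (t + k * N) = h t + k * (d + N) := by
  induction k with
  | zero => simp
  | succ k ih =>
    rw [show t + ((k : ℤ) + 1) * N = (t + k * N) + N by ring, hh.add_period, ih]; ring
  | pred k ih =>
    have := hh.add_period (t + (-(k : ℤ) - 1) * N)
    rw [show t + (-(k : ℤ) - 1) * N + N = t + -(k : ℤ) * N by ring, ih] at this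
    linarith

lemma IsHoleSeq.apply_of_congr {x y : ℤ → ℤ} (hx : IsHoleSeq d N ε x) (hy : IsHoleSeq d N ε y)
    {s u : ℤ} (hsu : congrSetoid N s u) : x u - x s = y u - y s := by
  obtain ⟨k, hk⟩ := hsu
  obtain rfl : u = s + k * N := by linarith
  rw [hx.add_mul_period, hy.add_mul_period]; ring

/-- The required colour depends on the index alone, so it may be checked for whichever of the two
values is the larger. -/
lemma IsHoleSeq.sup {x y : ℤ → ℤ} (hx : IsHoleSeq d N ε x) (hy : IsHoleSeq d N ε y) :
    IsHoleSeq d N ε (x ⊔ y) where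
  lt_succ t := max_lt_max (hx.lt_succ t) (hy.lt_succ t)
  add_period t := by
    simp only [Pi.sup_apply, hx.add_period, hy.add_period]
    exact max_add_add_right _ _ _
  parity t := by
    rcases max_choice (x t) (y t) with h | h
    · simp only [Pi.sup_apply, h, hx.parity]
    · simp only [Pi.sup_apply, h, hy.parity]

lemma IsHoleSeq.inf {x y : ℤ → ℤ} (hx : IsHoleSeq d N ε x) (hy : IsHoleSeq d N ε y) :
    IsHoleSeq d N ε (x ⊓ y) where
  lt_succ t := min_lt_min (hx.lt_succ t) (hy.lt_succ t)
  add_period t := by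
    simp only [Pi.inf_apply, hx.add_period, hy.add_period]
    exact min_add_add_right _ _ _
  parity t := by
    rcases min_choice (x t) (y t) with h | h
    · simp only [Pi.inf_apply, h, hx.parity]
    · simp only [Pi.inf_apply, h, hy.parity]

/-- Move the holes of the class of `s`, so that the hole `s` comes to `q`. -/
def moveHole (d N : ℕ) (h : ℤ → ℤ) (s q : ℤ) : ℤ → ℤ := fun t =>
  if (N : ℤ) ∣ t - s then q + (t - s) / N * (d + N) else h t

lemma moveHole_self (h : ℤ → ℤ) (s q : ℤ) : moveHole d N h s q s = q := by
  simp [moveHole]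

lemma moveHole_of_not (h : ℤ → ℤ) {s t : ℤ} (q : ℤ) (ht : ¬ congrSetoid N s t) :
    moveHole d N h s q t = h t := if_neg ht

lemma agreeOff_moveHole (h : ℤ → ℤ) (s q : ℤ) :
    AgreeOff (congrSetoid N) s h (moveHole d N h s q) :=
  fun _ ht => (moveHole_of_not h q ht).symm

/-- Since `N ≥ 2`, the indices `s ± 1` are not in the class of `s`, so they keep their places and
the conditions at `s` imply those at all translates. -/
lemma IsHoleSeq.moveHole (hN : 2 ≤ N) {h : ℤ → ℤ} (hh : IsHoleSeq d N ε h) {s q : ℤ}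
    (hl : h (s - 1) < q) (hr : q < h (s + 1)) (hq : (colourPos d N q + s + ε) % 2 = 0) :
    IsHoleSeq d N ε (moveHole d N h s q) := by
  have hN0 : (N : ℤ) ≠ 0 := by positivity
  have hval : ∀ k : ℤ, _root_.moveHole d N h s q (s + k * N) = q + k * (d + N) := fun k => by
    simp [_root_.moveHole, Int.mul_ediv_cancel _ hN0]
  have hone : ¬ (N : ℤ) ∣ 1 := fun h1 => by have := Int.le_of_dvd one_pos h1; omega
  have hnot1 : ∀ k : ℤ, ¬ congrSetoid N s (s + k * N + 1) := fun k h1 => hone <| by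
    rw [congrSetoid_iff] at h1
    have := dvd_sub h1 (Dvd.intro_left k rfl); ring_nf at this; exact this
  have hnot2 : ∀ k : ℤ, ¬ congrSetoid N s (s + k * N - 1) := fun k h1 => hone <| by
    rw [congrSetoid_iff] at h1
    have := dvd_sub (Dvd.intro_left k rfl) h1; ring_nf at this; exact this
  refine ⟨fun t => ?_, fun t => ?_, fun t => ?_⟩
  · by_cases h1 : congrSetoid N s t
    · obtain ⟨k, hk⟩ := h1
      obtain rfl : t = s + k * N := by linarith
      rw [hval, moveHole_of_not _ _ (hnot1 k), show s + k * N + 1 = s + 1 + k * N by ring,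
        hh.add_mul_period]
      linarith
    · by_cases h2 : congrSetoid N s (t + 1)
      · obtain ⟨k, hk⟩ := h2
        obtain rfl : t = s + k * N - 1 := by linarith
        rw [moveHole_of_not _ _ h1, sub_add_cancel, hval,
          show s + k * N - 1 = s - 1 + k * N by ring, hh.add_mul_period]
        linarith
      · rw [moveHole_of_not _ _ h1, moveHole_of_not _ _ h2]; exact hh.lt_succ t
  · by_cases h1 : congrSetoid N s t
    · obtain ⟨k, hk⟩ := h1
      obtain rfl : t = s + k * N := by linarith
      rw [show s + k * N + N = s + (k + 1) * N by ring, hval, hval]; ring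
    · have h2 : ¬ congrSetoid N s (t + N) := fun h2 => h1 <| by
        rw [congrSetoid_iff] at h2 ⊢
        have := dvd_sub h2 (dvd_refl (N : ℤ)); ring_nf at this ⊢; exact this
      rw [moveHole_of_not _ _ h1, moveHole_of_not _ _ h2, hh.add_period]
  · by_cases h1 : congrSetoid N s t
    · obtain ⟨k, hk⟩ := h1
      obtain rfl : t = s + k * N := by linarith
      rw [hval, colourPos_add_mul (by omega)]
      generalize k * (N : ℤ) = m
      omega
    · rw [moveHole_of_not _ _ h1]; exact hh.parity t

lemma wStep_walk_symm {W : Set (ℤ → ℤ)} {x y : ℤ → ℤ}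
    (h : Relation.ReflTransGen (WStep (congrSetoid N) W) x y) :
    Relation.ReflTransGen (WStep (congrSetoid N) W) y x := by
  induction h with
  | refl => exact .refl
  | tail _ hbc ih => exact .head hbc.symm ih

/-- A hole that cannot be moved upwards within `W`, although there is room for it and little
enough room is used, is never moved by a walk in `W`. -/
theorem UniqueExit.apply_eq_of_lt (hN : 2 ≤ N) {W : Set (ℤ → ℤ)}
    (hU : UniqueExit (congrSetoid N) {h | IsHoleSeq d N ε h} W) {z g : ℤ → ℤ} {s : ℤ}
    (hz : z ∈ W) (hg : IsHoleSeq d N ε g) (hgW : g ∉ W)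
    (hzg : AgreeOff (congrSetoid N) s z g) (hlt : z s < g s)
    (hcap : offSeamPos d N (g s) - offSeamPos d N (z s) < d - 1)
    {x : ℤ → ℤ} (hx : Relation.ReflTransGen (WStep (congrSetoid N) W) z x) : x s = z s := by
  have hN0 : (0 : ℤ) < N := by omega
  have hnc : ∀ u, s + 1 ≤ u → u < s + N → ¬ congrSetoid N s u := fun u h1 h2 h3 => by
    have := Int.le_of_dvd (by omega) (congrSetoid_iff.1 h3); omega
  -- Sequences reachable in `W` in which hole `s` has its old place and is still blocked in the same
  -- way. A member with least total distance from hole `s` to the next `N` holes is packed as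
  -- tightly as `W` permits.
  set S : Set (ℤ → ℤ) := {y | y ∈ W ∧ Relation.ReflTransGen (WStep (congrSetoid N) W) z y ∧
    y s = z s ∧ ∃ g', IsHoleSeq d N ε g' ∧ g' ∉ W ∧ AgreeOff (congrSetoid N) s y g' ∧
      g' s = g s} with hS
  obtain ⟨y, ⟨hyW, hzy, hys, g', hg', hg'W, hyg, hgs⟩, hmin⟩ :=
    (measure fun y : ℤ → ℤ => (∑ i ∈ Finset.range N, (y (s + 1 + i) - y s)).toNat).wf.has_min S
      ⟨z, hz, .refl, rfl, g, hg, hgW, hzg, rfl⟩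
  have hy : IsHoleSeq d N ε y := hU.subset hyW
  have hperi := hy.add_period s
  have hperi' := hg'.add_period s
  -- In the packed sequence, any admissible lowering of a hole `u` leads out of `W`, so by the dual
  -- bound no walk lowers it. For `u = s + 1` the target must also lie above `g s`, so that the same
  -- lowering is possible in `g'`.
  have hlow : ∀ u q, s + 1 ≤ u → u ≤ s + N → y (u - 1) < q → q < y u →
      (colourPos d N q + u + ε) % 2 = 0 → (u = s + 1 → g s < q) →
      ∀ x, Relation.ReflTransGen (WStep (congrSetoid N) W) z x → y u ≤ x u := by
    intro u q hu1 hu2 hq1 hq2 hqc hqs x hx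
    have hy' := hy.moveHole hN hq1 (hq2.trans (hy.lt_succ u)) hqc
    have hyx := (wStep_walk_symm hzy).trans hx
    refine hU.le_apply hyW hy' (fun hy'W => ?_) (agreeOff_moveHole y u q)
      (by rw [moveHole_self]; exact hq2) hyx
    -- Hole `s + N` moves together with hole `s`: lowering it within `W` would give `g'` a second
    -- neighbour in `W` besides `y`.
    by_cases hus : u = s + N
    · have hcl : AgreeOff (congrSetoid N) s y (_root_.moveHole d N y u q) := fun v hv =>
        agreeOff_moveHole y u q v fun h => hv <| by
          rw [congrSetoid_iff] at h ⊢
          rw [hus] at h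
          have := dvd_add h (dvd_refl (N : ℤ)); ring_nf at this ⊢; exact this
      have := hU.unique g' hg' hg'W y hyW _ hy'W s s hyg.symm (hyg.symm.trans hcl)
      have h2 := moveHole_self (d := d) (N := N) y u q
      rw [← this] at h2
      omega
    · have hsu := hnc u hu1 (by omega)
      have hsu' : ¬ congrSetoid N u s := fun h => hsu ((congrSetoid N).symm h)
      have hgu : g' u = y u := (hyg u hsu).symm
      have hgl : g' (u - 1) < q := by
        by_cases h1 : u = s + 1
        · rw [h1, add_sub_cancel_right, hgs]; exact hqs h1
        · rw [← hyg (u - 1) (hnc _ (by omega) (by omega))]; exact hq1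
      have hg'' := hg'.moveHole hN hgl ((hgu ▸ hq2).trans (hg'.lt_succ u)) hqc
      -- Were the lowered sequence in `W`, it would lie in `S`, contradicting minimality: the same
      -- lowering of `g'` is not in `W`, as otherwise `g'` would have two neighbours there.
      refine hmin (_root_.moveHole d N y u q) ⟨hy'W, hzy.tail ⟨hyW, hy'W, u,
        agreeOff_moveHole y u q⟩, by rw [moveHole_of_not _ _ hsu', hys], _, hg'', fun hW => ?_,
        fun v hv => ?_, by rw [moveHole_of_not _ _ hsu', hgs]⟩ ?_
      · have := hU.unique g' hg' hg'W y hyW _ hW s u hyg.symm (agreeOff_moveHole g' u q)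
        have h2 := moveHole_of_not (d := d) g' q hsu'
        rw [← this] at h2
        omega
      · simp only [_root_.moveHole, hyg v hv]
      · have hle : ∀ v, s + 1 ≤ v → v ≤ s + N → _root_.moveHole d N y u q v ≤ y v := by
          have := hU.le_of_agreeOff hy' hy (agreeOff_moveHole y u q).symm
            (by rw [moveHole_self]; exact hq2.le)
          exact fun v _ _ => this v
        have hs' : _root_.moveHole d N y u q s = y s := moveHole_of_not _ _ hsu'
        have hpos : 0 ≤ ∑ i ∈ Finset.range N, (_root_.moveHole d N y u q (s + 1 + i)
            - _root_.moveHole d N y u q s) := Finset.sum_nonneg fun i _ => by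
          have := hy'.strictMono (show s < s + 1 + (i : ℤ) by omega); omega
        have hlt' : ∑ i ∈ Finset.range N, (_root_.moveHole d N y u q (s + 1 + i)
            - _root_.moveHole d N y u q s) < ∑ i ∈ Finset.range N, (y (s + 1 + i) - y s) := by
          refine Finset.sum_lt_sum (fun i hi => ?_) ⟨(u - s - 1).toNat, ?_, ?_⟩
          · have := hle (s + 1 + i) (by omega) (by have := Finset.mem_range.1 hi; omega)
            omega
          · rw [Finset.mem_range]; omega
          · rw [show s + 1 + ((u - s - 1).toNat : ℤ) = u by omega, moveHole_self, hs']
            omega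
        show Int.toNat _ < Int.toNat _
        omega
  -- Counting. If nothing could be lowered, the `N` gaps from `g s` to hole `s + N` would each use
  -- at most one off-seam position, whereas a period from `z s` contains `d + N - 1` of them.
  have hex : ∃ u q, s + 1 ≤ u ∧ u ≤ s + N ∧ y (u - 1) < q ∧ q < y u ∧
      (colourPos d N q + u + ε) % 2 = 0 ∧ (u = s + 1 → g s < q) := by
    by_contra! hno
    have h1 : offSeamPos d N (y (s + 1)) ≤ offSeamPos d N (g s) + 1 := by
      have hys1 : g' (s + 1) = y (s + 1) := (hyg _ (hnc _ le_rfl (by omega))).symm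
      have hlt1 := hg'.lt_succ s
      have hp1 := hy.parity (s + 1)
      have hp2 := hg'.parity s
      rw [hgs] at hp2 hlt1
      rw [hys1] at hlt1
      refine offSeamPos_le_of_no_between (by omega) hlt1 (by omega) fun q hq1 hq2 => ?_
      by_contra hc
      have := (hno (s + 1) q le_rfl (by omega)
        (by rw [add_sub_cancel_right]; omega) hq2 (by omega)).2
      omega
    have h2 : ∀ k : ℕ, k < N → offSeamPos d N (y (s + 1 + k)) ≤ offSeamPos d N (g s) + 1 + k := by
      intro k
      induction k with
      | zero => intro _; simpa using h1
      | succ k ih =>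
        intro hk
        have hlt1 := hy.lt_succ (s + 1 + k)
        have hp1 := hy.parity (s + 1 + k)
        have hp2 := hy.parity (s + 1 + k + 1)
        have := offSeamPos_le_of_no_between (d := d) (N := N) (by omega) hlt1 (by omega)
          fun q hq1 hq2 => by
            by_contra hc
            have := (hno (s + 1 + k + 1) q (by omega) (by omega)
              (by rw [add_sub_cancel_right]; omega) hq2 (by omega)).1
            omega
        have ih := ih (by omega)
        push_cast
        rw [← add_assoc]
        omega
    have h3 := h2 (N - 1) (by omega)
    rw [show s + 1 + ((N - 1 : ℕ) : ℤ) = s + N by omega, hperi, offSeamPos_add (by omega),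
      hys] at h3
    omega
  obtain ⟨u, q, hu1, hu2, hq1, hq2, hqc, hqs⟩ := hex
  -- If a walk keeps hole `v` above its packed place but brings `v + 1` below its own, the place of
  -- `v + 1` in `x` is itself an admissible target for lowering it in `y`, which `hlow` excludes.
  have hchain : ∀ v, u ≤ v → v ≤ s + N →
      ∀ x, Relation.ReflTransGen (WStep (congrSetoid N) W) z x → y v ≤ x v := by
    intro v huv
    induction v, huv using Int.leInduction with
    | base => exact fun _ => hlow u q hu1 hu2 hq1 hq2 hqc hqs
    | succ v huv ih =>
      intro hv x hx
      by_contra! hlt'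
      have hxC : IsHoleSeq d N ε x := by
        rcases hx.cases_tail with rfl | ⟨_, _, h⟩
        exacts [hU.subset hz, hU.subset h.2.1]
      have h1 := ih (by omega) x hx
      have := hlow (v + 1) (x (v + 1)) (by omega) hv
        (by rw [add_sub_cancel_right]; exact h1.trans_lt (hxC.lt_succ v)) hlt'
        (hxC.parity (v + 1)) (by omega) x hx
      omega
  have hxC : IsHoleSeq d N ε x := by
    rcases hx.cases_tail with rfl | ⟨_, _, h⟩
    exacts [hU.subset hz, hU.subset h.2.1]
  have h1 := hchain (s + N) hu2 le_rfl x hx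
  have h2 := hU.apply_le hz hg hgW hzg hlt hx
  have h3 := hxC.add_period s
  omega

end HoleSequences

/-! ### Reflection, and the freezing criterion in both directions -/

section HoleSequences

variable {d N : ℕ} {ε : ℤ}

lemma uniqueExit_isHoleSeq {W : Set (ℤ → ℤ)} (hW : W ⊆ {h | IsHoleSeq d N ε h})
    (hU : ∀ g, IsHoleSeq d N ε g → g ∉ W → ∀ x ∈ W, ∀ y ∈ W, ∀ s s',
      AgreeOff (congrSetoid N) s g x → AgreeOff (congrSetoid N) s' g y → x = y) :
    UniqueExit (congrSetoid N) {h | IsHoleSeq d N ε h} W where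
  sup_mem _ hx _ hy := hx.sup hy
  inf_mem _ hx _ hy := hx.inf hy
  le_of_le x hx y hy s u hsu h := by
    have := IsHoleSeq.apply_of_congr hx hy hsu; omega
  subset := hW
  unique := hU

/-- The reflection of a bi-infinite sequence of integers. -/
def reflectSeq (h : ℤ → ℤ) : ℤ → ℤ := fun t => -1 - h (-t)

lemma reflectSeq_reflectSeq (h : ℤ → ℤ) : reflectSeq (reflectSeq h) = h := by
  funext t; simp [reflectSeq]

/-- The map `a ↦ -1 - a` sends period blocks to period blocks, with quotient `q` becoming `-1 - q`;
the colour is therefore reversed up to a constant. -/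
lemma colourPos_reflect (h : 0 < d + N) (a : ℤ) :
    colourPos d N (-1 - a) = -colourPos d N a - 1 - d := by
  have hn : (0 : ℤ) < (d : ℤ) + N := by exact_mod_cast h
  have : (-1 - a) / ((d : ℤ) + N) = -1 - a / (d + N) := by
    have b1 := Int.emod_nonneg a hn.ne'
    have b2 := Int.emod_lt_of_pos a hn
    have e1 := Int.emod_add_mul_ediv a (d + N)
    rw [show -1 - a = ((d : ℤ) + N - 1 - a % (d + N)) + (-1 - a / (d + N)) * (d + N) by
      linarith, Int.add_mul_ediv_right _ _ hn.ne', Int.ediv_eq_zero_of_lt (by omega) (by omega)]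
    simp
  simp only [colourPos, this]
  ring

lemma IsHoleSeq.reflect (hn : 0 < d + N) {h : ℤ → ℤ} (hh : IsHoleSeq d N ε h) {ε' : ℤ}
    (hε : (ε' + ε + 1 + d) % 2 = 0) : IsHoleSeq d N ε' (reflectSeq h) where
  lt_succ t := by
    have := hh.lt_succ (-(t + 1))
    rw [show -(t + 1) + 1 = -t by ring] at this
    simp only [reflectSeq]; omega
  add_period t := by
    have := hh.add_period (-(t + N))
    rw [show -(t + (N : ℤ)) + N = -t by ring] at this
    simp only [reflectSeq]; omega
  parity t := by
    have := hh.parity (-t)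
    simp only [reflectSeq, colourPos_reflect hn]; omega

lemma AgreeOff.reflect {s : ℤ} {x y : ℤ → ℤ} (h : AgreeOff (congrSetoid N) s x y) :
    AgreeOff (congrSetoid N) (-s) (reflectSeq x) (reflectSeq y) := fun u hu => by
  have : x (-u) = y (-u) := h (-u) fun h' => hu <| by
    rw [congrSetoid_iff] at h' ⊢
    have := h'.neg_right; rwa [show -(-u - s) = u - -s by ring] at this
  simp only [reflectSeq, this]

/-- A version of `UniqueExit.apply_eq_of_lt` that allows both directions. -/
theorem UniqueExit.apply_eq_of_seam (hd : 2 ≤ d) (hN : 2 ≤ N) {W : Set (ℤ → ℤ)}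
    (hU : UniqueExit (congrSetoid N) {h | IsHoleSeq d N ε h} W) {z g : ℤ → ℤ} {s : ℤ}
    (hz : z ∈ W) (hg : IsHoleSeq d N ε g) (hgW : g ∉ W)
    (hzg : AgreeOff (congrSetoid N) s z g) (hlt : z s < g s)
    (hcap : 4 ≤ d ∨ g s = z s + 1)
    {x : ℤ → ℤ} (hx : Relation.ReflTransGen (WStep (congrSetoid N) W) z x) : x s = z s := by
  have hzC : IsHoleSeq d N ε z := hU.subset hz
  have p1 := hzC.parity s
  have p2 := hg.parity s
  have h1 := pos_succ (d := d) (N := N) (by omega) (z s)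
  have hone : ¬ (N : ℤ) ∣ 1 := fun h1 => by have := Int.le_of_dvd one_pos h1; omega
  have hs1 : ¬ congrSetoid N s (s + 1) := fun h => hone <| by
    rw [congrSetoid_iff, add_sub_cancel_left] at h; exact h
  have hzg1 := hzg (s + 1) hs1
  have hgs1 := hg.lt_succ s
  -- The first place of the right colour above `z s` is at distance at most three, three occurring
  -- only when the seam lies in between; so it costs at most two off-seam positions, fewer than `d -
  -- 1` for `d ≥ 4`. A colour-preserving move by one crosses the seam and costs none.
  have hex : ∃ q, z s < q ∧ q ≤ g s ∧ (colourPos d N q + s + ε) % 2 = 0 ∧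
      offSeamPos d N q - offSeamPos d N (z s) < d - 1 := by
    rcases hcap with hd4 | hcap
    · have h2 := pos_succ (d := d) (N := N) (by omega) (z s + 1)
      have h3 := pos_succ (d := d) (N := N) (by omega) (z s + 1 + 1)
      by_cases c1 : (colourPos d N (z s + 1) + s + ε) % 2 = 0
      · exact ⟨z s + 1, by omega, by omega, c1, by omega⟩
      have n1 : g s ≠ z s + 1 := fun h => c1 (h ▸ p2)
      by_cases c2 : (colourPos d N (z s + 1 + 1) + s + ε) % 2 = 0
      · exact ⟨z s + 1 + 1, by omega, by omega, c2, by omega⟩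
      have n2 : g s ≠ z s + 1 + 1 := fun h => c2 (h ▸ p2)
      have hs2 : (d + N : ℤ) ∣ z s + 1 + 1 := by
        by_contra hs2
        have := h2.resolve_left fun h => hs2 h.1
        omega
      have hs3 : ¬ (d + N : ℤ) ∣ z s + 1 + 1 + 1 := by
        intro hs3
        have h4 := dvd_sub hs3 hs2
        have := Int.le_of_dvd (by omega) h4
        omega
      have h2' := h2.resolve_right fun h => h.1 hs2
      have h3' := h3.resolve_left fun h => hs3 h.1
      exact ⟨z s + 1 + 1 + 1, by omega, by omega, by omega, by omega⟩
    · refine ⟨g s, hlt, le_rfl, p2, ?_⟩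
      rw [hcap] at p2 ⊢
      omega
  obtain ⟨q, hq1, hq2, hqc, hqψ⟩ := hex
  have hz1 := hzC.lt_succ (s - 1)
  rw [sub_add_cancel] at hz1
  refine hU.apply_eq_of_lt hN hz (hzC.moveHole hN (hz1.trans hq1) (by omega) hqc) (fun hW => ?_)
    (agreeOff_moveHole z s q) (by rwa [moveHole_self]) (by rwa [moveHole_self]) hx
  -- The shorter move also leaves `W`; otherwise `g` would have both `z` and its result as
  -- neighbours in `W`.
  have := hU.unique g hg hgW z hz _ hW s s hzg.symm (hzg.symm.trans (agreeOff_moveHole z s q))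
  have h2 := moveHole_self (d := d) (N := N) z s q
  rw [← this] at h2
  omega

/-- If the hole `s` of a member of `W` can be moved out of `W`, then it is constant along all
walks in `W`, for `d ≥ 4`; for `d ≥ 2` this still holds if the move crosses the seam. -/
theorem UniqueExit.apply_eq (hd : 2 ≤ d) (hN : 2 ≤ N) {W : Set (ℤ → ℤ)}
    (hU : UniqueExit (congrSetoid N) {h | IsHoleSeq d N ε h} W) {z g : ℤ → ℤ} {s : ℤ}
    (hz : z ∈ W) (hg : IsHoleSeq d N ε g) (hgW : g ∉ W)
    (hzg : AgreeOff (congrSetoid N) s z g) (hne : z s ≠ g s)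
    (hcap : 4 ≤ d ∨ g s = z s + 1 ∨ z s = g s + 1)
    {x : ℤ → ℤ} (hx : Relation.ReflTransGen (WStep (congrSetoid N) W) z x) : x s = z s := by
  rcases hne.lt_or_gt with hlt | hlt
  · exact hU.apply_eq_of_seam hd hN hz hg hgW hzg hlt (by omega) hx
  have hn : 0 < d + N := by omega
  set ε' : ℤ := ε + 1 + d
  set W' : Set (ℤ → ℤ) := {h | reflectSeq h ∈ W} with hW'
  have hmem : ∀ {h}, h ∈ W → reflectSeq h ∈ W' := fun h => by
    rw [hW', Set.mem_ofPred_eq, reflectSeq_reflectSeq]; exact h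
  have hU' : UniqueExit (congrSetoid N) {h | IsHoleSeq d N ε' h} W' := by
    refine uniqueExit_isHoleSeq (fun h hh => ?_) fun g hg hgW x hx y hy s s' h1 h2 => ?_
    · have h1 : IsHoleSeq d N ε (reflectSeq h) := hU.subset hh
      have := h1.reflect hn (ε' := ε') (by omega)
      rwa [reflectSeq_reflectSeq] at this
    · have := hU.unique _ (hg.reflect hn (by omega)) hgW _ hx _ hy _ _ h1.reflect h2.reflect
      rw [← reflectSeq_reflectSeq x, this, reflectSeq_reflectSeq]
  have hx' : Relation.ReflTransGen (WStep (congrSetoid N) W') (reflectSeq z) (reflectSeq x) :=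
    hx.lift reflectSeq fun a b h => ⟨hmem h.1, hmem h.2.1, h.2.2.elim fun s hs => ⟨-s, hs.reflect⟩⟩
  have := hU'.apply_eq_of_seam hd hN (hmem hz) (hg.reflect hn (by omega))
    (fun h => hgW (by rwa [hW', Set.mem_ofPred_eq, reflectSeq_reflectSeq] at h)) hzg.reflect
    (by simp only [reflectSeq, neg_neg]; omega) (by simp only [reflectSeq, neg_neg]; omega) hx'
  simp only [reflectSeq, neg_neg] at this
  omega

end HoleSequences

/-! ### Gale facets as hole sequences -/

section Facets

/-- Gale's evenness condition. -/
def IsGale {n : ℕ} (S : Finset (Fin n)) : Prop :=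
  ∃ e, ∀ j ∉ S, (S.filter (· < j)).card % 2 = e

/-- The vertex sets of the facets of the cyclic polytope. -/
def IsCyclicFacet (d : ℕ) {n : ℕ} (S : Finset (Fin n)) : Prop :=
  S.card = d ∧ IsGale S

open Classical in
/-- The elements of `{0, …, d + N - 1}` that are not holes. -/
noncomputable def holeFree (d N : ℕ) (h : ℤ → ℤ) : Finset (Fin (d + N)) :=
  Finset.univ.filter fun i => ∀ t, h t ≠ (i : ℕ)

variable {d N : ℕ} {ε : ℤ}

lemma mem_holeFree {h : ℤ → ℤ} {i : Fin (d + N)} :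
    i ∈ holeFree d N h ↔ ∀ t, h t ≠ (i : ℕ) := by simp [holeFree]

lemma notMem_holeFree {h : ℤ → ℤ} {i : Fin (d + N)} :
    i ∉ holeFree d N h ↔ ∃ t, h t = (i : ℕ) := by simp [holeFree]

lemma IsHoleSeq.exists_between {h : ℤ → ℤ} (hh : IsHoleSeq d N ε h) (a : ℤ) :
    ∃ u, h u ≤ a ∧ a < h (u + 1) := by
  have hup : ∀ k : ℕ, h 0 + k ≤ h k := fun k => by
    induction k with
    | zero => simp
    | succ k ih => have := hh.lt_succ k; push_cast at *; omega
  have hdown : ∀ k : ℕ, h (-k) ≤ h 0 - k := fun k => by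
    induction k with
    | zero => simp
    | succ k ih =>
      have := hh.lt_succ (-((k : ℤ) + 1))
      rw [show -((k : ℤ) + 1) + 1 = -k by ring] at this
      push_cast at *; omega
  obtain ⟨u, hu, hmax⟩ := Int.exists_greatest_of_bdd (P := fun u => h u ≤ a)
    ⟨(a - h 0).toNat + 1, fun u hu => by
      by_contra! hlt
      have h1 := hup ((a - h 0).toNat + 1)
      have h2 := hh.strictMono hlt
      push_cast at h1
      omega⟩
    ⟨-((h 0 - a).toNat : ℤ), by have := hdown (h 0 - a).toNat; omega⟩
  refine ⟨u, hu, ?_⟩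
  by_contra! hlt
  have := hmax _ hlt
  omega

/-- Here `t₀` is the first nonnegative hole, so the holes in `[0, h t)` are those with indices from
`t₀` to `t - 1`; all other positions there are counted. -/
lemma IsHoleSeq.card_filter {h : ℤ → ℤ} (hh : IsHoleSeq d N ε h) {t₀ t : ℤ}
    (h0 : 0 ≤ h t₀) (h0' : h (t₀ - 1) < 0) (ht : t₀ ≤ t) (htn : h t ≤ d + N) :
    ((((holeFree d N h).filter fun i : Fin (d + N) => ((i : ℕ) : ℤ) < h t).card : ℕ) : ℤ) = h t - (t - t₀) := by
  have hmono := hh.strictMono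
  have hht : 0 ≤ h t := h0.trans (hmono.monotone ht)
  have h1 : ((Finset.univ.filter fun i : Fin (d + N) => ((i : ℕ) : ℤ) < h t).card : ℤ) = h t := by
    have : (Finset.univ.filter fun i : Fin (d + N) => ((i : ℕ) : ℤ) < h t).card
        = (Finset.range (h t).toNat).card := by
      refine Finset.card_bij (fun i _ => (i : ℕ)) (fun i hi => ?_)
        (fun i _ j _ hij => Fin.ext hij) (fun b hb => ?_)
      · simp at hi ⊢; omega
      · rw [Finset.mem_range] at hb
        exact ⟨⟨b, by omega⟩, by simp; omega, rfl⟩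
    rw [this, Finset.card_range]; omega
  have h2 : ((Finset.univ.filter fun i : Fin (d + N) => ((i : ℕ) : ℤ) < h t).filter
      fun i => i ∉ holeFree d N h).card = (Finset.Ico t₀ t).card := by
    symm
    refine Finset.card_bij (fun u hu => ⟨(h u).toNat, ?_⟩) (fun u hu => ?_)
      (fun u hu v hv huv => ?_) (fun i hi => ?_)
    · have := hmono (Finset.mem_Ico.1 hu).2
      have := h0.trans (hmono.monotone (Finset.mem_Ico.1 hu).1)
      omega
    · have h3 := hmono (Finset.mem_Ico.1 hu).2
      have h4 := h0.trans (hmono.monotone (Finset.mem_Ico.1 hu).1)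
      simp only [Finset.mem_filter, Finset.mem_univ, true_and, notMem_holeFree]
      exact ⟨by omega, u, by omega⟩
    · have h4 := h0.trans (hmono.monotone (Finset.mem_Ico.1 hu).1)
      have h5 := h0.trans (hmono.monotone (Finset.mem_Ico.1 hv).1)
      simp only [Fin.mk.injEq] at huv
      exact hmono.injective (by omega)
    · simp only [Finset.mem_filter, Finset.mem_univ, true_and, notMem_holeFree] at hi
      obtain ⟨hi, u, hu⟩ := hi
      refine ⟨u, Finset.mem_Ico.2 ⟨?_, hmono.lt_iff_lt.1 (hu ▸ hi)⟩, Fin.ext (by simp [hu])⟩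
      by_contra! hlt
      have := hmono.monotone (show u ≤ t₀ - 1 by omega)
      omega
  have h3 := Finset.card_filter_add_card_filter_not
    (s := Finset.univ.filter fun i : Fin (d + N) => ((i : ℕ) : ℤ) < h t)
    (fun i => i ∈ holeFree d N h)
  rw [h2, Int.card_Ico] at h3
  have h4 : (Finset.univ.filter fun i : Fin (d + N) => ((i : ℕ) : ℤ) < h t).filter
      (fun i => i ∈ holeFree d N h) =
      (holeFree d N h).filter fun i : Fin (d + N) => ((i : ℕ) : ℤ) < h t := by
    ext i; simp [and_comm]
  rw [h4] at h3
  omega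

/-- A period contains `N` holes, which leaves `d` elements. Below the hole `h t` there are `h t - (t
- t₀)` of them, and in the base period the colour is the position, so alternation fixes the parity
of this number. -/
lemma IsHoleSeq.isCyclicFacet (hN : 0 < N) {h : ℤ → ℤ} (hh : IsHoleSeq d N ε h) :
    IsCyclicFacet d (holeFree d N h) := by
  obtain ⟨u, hu1, hu2⟩ := hh.exists_between (-1)
  have h0 : 0 ≤ h (u + 1) := by omega
  have h0' : h (u + 1 - 1) < 0 := by rw [add_sub_cancel_right]; omega
  have hper := hh.add_period u
  constructor
  · obtain ⟨v, hv1, hv2⟩ := hh.exists_between (d + N - 1)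
    have hvu : v = u + N := by
      have hper1 := hh.add_period (u + 1)
      have h1 : u + N < v + 1 := hh.strictMono.lt_iff_lt.1 (by omega)
      have h2 : v < u + 1 + N := hh.strictMono.lt_iff_lt.1 (by omega)
      omega
    have h3 : ∀ i : Fin (d + N), ((i : ℕ) : ℤ) ≤ h v ∨ i ∈ holeFree d N h := fun i => by
      by_contra! hc
      obtain ⟨hc, hc'⟩ := hc
      obtain ⟨t, ht⟩ := notMem_holeFree.1 hc'
      have h1 : v < t := hh.strictMono.lt_iff_lt.1 (by omega)
      have := hh.strictMono.monotone (show v + 1 ≤ t by omega)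
      omega
    have h4 := hh.card_filter h0 h0' (t := v) (by omega) (by omega)
    have h5 := Finset.card_filter_add_card_filter_not (s := holeFree d N h)
      (fun i : Fin (d + N) => ((i : ℕ) : ℤ) < h v)
    have h6 : ((holeFree d N h).filter fun i : Fin (d + N) => ¬ ((i : ℕ) : ℤ) < h v).card
        = (Finset.Ico (h v + 1) (d + N)).card := by
      refine Finset.card_bij (fun i _ => ((i : ℕ) : ℤ)) (fun i hi => ?_)
        (fun i _ j _ hij => Fin.ext (Int.ofNat_inj.1 hij)) (fun b hb => ?_)
      · rw [Finset.mem_filter, mem_holeFree] at hi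
        have := hi.1 v
        rw [Finset.mem_Ico]; omega
      · rw [Finset.mem_Ico] at hb
        have hv0 : 0 ≤ h v := h0.trans (hh.strictMono.monotone (by omega))
        refine ⟨⟨b.toNat, by omega⟩, ?_, by simp; omega⟩
        rw [Finset.mem_filter]
        have h7 := h3 ⟨b.toNat, by omega⟩
        have h8 : ((b.toNat : ℕ) : ℤ) = b := by omega
        simp only [h8] at h7 ⊢
        exact ⟨h7.resolve_left (by omega), by omega⟩
    rw [h6, Int.card_Ico] at h5
    omega
  · refine ⟨((u + 1 + ε) % 2).toNat, fun j hj => ?_⟩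
    obtain ⟨t, ht⟩ := notMem_holeFree.1 hj
    have htu : u + 1 ≤ t := by
      by_contra! hlt
      have := hh.strictMono.monotone (show t ≤ u + 1 - 1 by omega)
      omega
    have h4 := hh.card_filter h0 h0' htu (by omega)
    have h5 : ((holeFree d N h).filter fun i : Fin (d + N) => ((i : ℕ) : ℤ) < h t) =
        (holeFree d N h).filter (· < j) := by
      ext i; rw [ht]; simp
    rw [h5] at h4
    have h6 := hh.parity t
    have h7 : colourPos d N (h t) = h t := by
      simp only [colourPos]
      rw [Int.ediv_eq_zero_of_lt (by omega) (by omega)]; simp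
    rw [h7] at h6
    omega

/-- Enumerate the complement increasingly and continue it periodically. The hole of index `r` has
`r` holes below it, so Gale's parity serves as the phase `ε`. -/
lemma IsCyclicFacet.exists_isHoleSeq (hN : 0 < N) {S : Finset (Fin (d + N))}
    (hS : IsCyclicFacet d S) : ∃ ε h, IsHoleSeq d N ε h ∧ holeFree d N h = S := by
  obtain ⟨hcard, c, hc⟩ := hS
  have hcc : Sᶜ.card = N := by rw [Finset.card_compl, hcard, Fintype.card_fin]; omega
  set e := Sᶜ.orderEmbOfFin hcc
  have hemem : ∀ r, e r ∉ S := fun r => Finset.mem_compl.1 (Finset.orderEmbOfFin_mem Sᶜ hcc r)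
  set f : ℕ → ℤ := fun r => if hr : r < N then ((e ⟨r, hr⟩ : ℕ) : ℤ) else 0 with hf
  have hfval : ∀ r (hr : r < N), f r = ((e ⟨r, hr⟩ : ℕ) : ℤ) := fun r hr => dif_pos hr
  have hf0 : ∀ r, 0 ≤ f r ∧ f r < d + N := fun r => by
    by_cases hr : r < N
    · rw [hfval r hr]; have := (e ⟨r, hr⟩).2; omega
    · simp only [hf, dif_neg hr]; omega
  have hfmono : ∀ r, r + 1 < N → f r < f (r + 1) := fun r hr => by
    rw [hfval r (by omega), hfval _ hr]
    have : e ⟨r, by omega⟩ < e ⟨r + 1, hr⟩ := e.strictMono (by simp [Fin.lt_def])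
    exact_mod_cast Fin.lt_def.1 this
  have hfpar : ∀ r, r < N → (f r + r + c) % 2 = 0 := fun r hr => by
    rw [hfval r hr]
    have h1 := hc _ (hemem ⟨r, hr⟩)
    have h2 : (Sᶜ.filter (· < e ⟨r, hr⟩)).card = r := by
      have : Sᶜ.filter (· < e ⟨r, hr⟩) = (Finset.Iio (⟨r, hr⟩ : Fin N)).map e.toEmbedding := by
        ext j
        simp only [Finset.mem_filter, Finset.mem_map, Finset.mem_Iio]
        constructor
        · rintro ⟨hj, hlt⟩
          have : j ∈ Set.range e := by rw [Finset.range_orderEmbOfFin]; exact_mod_cast hj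
          obtain ⟨k, rfl⟩ := this
          exact ⟨k, e.lt_iff_lt.1 hlt, rfl⟩
        · rintro ⟨k, hk, rfl⟩
          exact ⟨Finset.orderEmbOfFin_mem Sᶜ hcc k, e.lt_iff_lt.2 hk⟩
      rw [this, Finset.card_map, Fin.card_Iio]
    have h3 : (S.filter (· < e ⟨r, hr⟩)).card + (Sᶜ.filter (· < e ⟨r, hr⟩)).card
        = (e ⟨r, hr⟩ : ℕ) := by
      rw [← Fin.card_Iio (e ⟨r, hr⟩), ← Finset.card_union_of_disjoint]
      · congr 1
        ext j
        simp only [Finset.mem_union, Finset.mem_filter, Finset.mem_compl, Finset.mem_Iio]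
        tauto
      · exact Finset.disjoint_filter_filter (disjoint_compl_right)
    omega
  have hN0 : (N : ℤ) ≠ 0 := by omega
  have hd0 : ((d : ℤ) + N) ≠ 0 := by omega
  set h : ℤ → ℤ := fun t => f (t % N).toNat + t / N * (d + N) with hh
  have hval : ∀ (r : ℕ) (k : ℤ), r < N → h (r + k * N) = f r + k * (d + N) := fun r k hr => by
    simp only [hh]
    rw [Int.add_mul_emod_self_right, Int.add_mul_ediv_right _ _ hN0,
      Int.emod_eq_of_lt (by omega) (by omega), Int.ediv_eq_zero_of_lt (by omega) (by omega)]
    simp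
  have hrep : ∀ t : ℤ, ∃ (r : ℕ) (k : ℤ), r < N ∧ t = r + k * N := fun t =>
    ⟨(t % N).toNat, t / N, by have := Int.emod_lt_of_pos t (show (0 : ℤ) < N by omega); omega, by
      have := Int.emod_add_mul_ediv t N
      have := Int.emod_nonneg t hN0
      rw [Int.toNat_of_nonneg this]; linarith⟩
  refine ⟨c, h, ⟨fun t => ?_, fun t => ?_, fun t => ?_⟩, ?_⟩
  · obtain ⟨r, k, hr, rfl⟩ := hrep t
    by_cases hr' : r + 1 < N
    · rw [hval r k hr, show (r : ℤ) + k * N + 1 = ((r + 1 : ℕ) : ℤ) + k * N by push_cast; ring,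
        hval _ k hr']
      have := hfmono r hr'
      omega
    · have : (r : ℤ) + k * N + 1 = ((0 : ℕ) : ℤ) + (k + 1) * N := by
        have : (r : ℤ) + 1 = N := by omega
        push_cast; linarith
      rw [hval r k hr, this, hval 0 _ hN]
      have := hf0 r
      have := hf0 0
      rw [add_mul]
      omega
  · obtain ⟨r, k, hr, rfl⟩ := hrep t
    rw [show (r : ℤ) + k * N + N = r + (k + 1) * N by ring, hval r k hr, hval r _ hr]
    ring
  · obtain ⟨r, k, hr, rfl⟩ := hrep t
    rw [hval r k hr, colourPos_add_mul (by omega)]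
    have h1 : colourPos d N (f r) = f r := by
      simp only [colourPos]
      rw [Int.ediv_eq_zero_of_lt (hf0 r).1 (hf0 r).2]; simp
    have := hfpar r hr
    rw [h1]
    generalize k * (N : ℤ) = m
    omega
  · ext i
    rw [mem_holeFree]
    constructor
    · intro hi
      by_contra hiS
      have : i ∈ Set.range e := by
        rw [Finset.range_orderEmbOfFin]; exact_mod_cast Finset.mem_compl.2 hiS
      obtain ⟨k, rfl⟩ := this
      exact hi (k : ℕ) (by have := hval k 0 k.2; simp at this; rw [this, hfval _ k.2])
    · intro hiS t ht
      obtain ⟨r, k, hr, rfl⟩ := hrep t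
      rw [hval r k hr] at ht
      have h1 := hf0 r
      have h2 := i.2
      have hk : k = 0 := by
        rcases lt_trichotomy k 0 with hk | hk | hk
        · have : k * ((d : ℤ) + N) ≤ -1 * (d + N) :=
            mul_le_mul_of_nonneg_right (by omega) (by omega)
          omega
        · exact hk
        · have : 1 * ((d : ℤ) + N) ≤ k * (d + N) :=
            mul_le_mul_of_nonneg_right (by omega) (by omega)
          omega
      rw [hk, hfval r hr] at ht
      have : e ⟨r, hr⟩ = i := Fin.ext (by simpa using ht)
      exact hemem _ (this ▸ hiS)

end Facets

/-! ### Adjacent facets and moves of a single hole -/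

section FacetGraph

/-- Two facets of the cyclic polytope share a ridge. -/
def FacetAdj (d : ℕ) {n : ℕ} (S T : Finset (Fin n)) : Prop :=
  S ≠ T ∧ (S ∩ T).card + 1 = d

lemma FacetAdj.symm {d n : ℕ} {S T : Finset (Fin n)} (h : FacetAdj d S T) : FacetAdj d T S :=
  ⟨h.1.symm, by rw [Finset.inter_comm]; exact h.2⟩

lemma facetAdj_of_erase_subset {d n : ℕ} {S T : Finset (Fin n)} (hS : S.card = d)
    (hT : T.card = d) (hne : S ≠ T) {a : Fin n} (h : S.erase a ⊆ T) : FacetAdj d S T := by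
  refine ⟨hne, ?_⟩
  have h1 : S.erase a ⊆ S ∩ T := Finset.subset_inter (Finset.erase_subset _ _) h
  have h2 := Finset.card_le_card h1
  have h3 := Finset.pred_card_le_card_erase (s := S) (a := a)
  have h4 : (S ∩ T).card < S.card := by
    refine Finset.card_lt_card ⟨Finset.inter_subset_left, fun h5 => hne ?_⟩
    exact Finset.eq_of_subset_of_card_le (h5.trans Finset.inter_subset_right) (by omega)
  omega

lemma FacetAdj.exists_exchange {d n : ℕ} {S T : Finset (Fin n)} (h : FacetAdj d S T)
    (hS : S.card = d) (hT : T.card = d) :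
    ∃ a b, a ∈ S ∧ a ∉ T ∧ b ∈ T ∧ b ∉ S ∧ ∀ i, i ∈ T ↔ (i ∈ S ∨ i = b) ∧ i ≠ a := by
  have h1 := Finset.card_sdiff_add_card_inter S T
  have h2 := Finset.card_sdiff_add_card_inter T S
  rw [Finset.inter_comm] at h2
  have h3 := h.2
  obtain ⟨a, ha⟩ := Finset.card_eq_one.1 (show (S \ T).card = 1 by omega)
  obtain ⟨b, hb⟩ := Finset.card_eq_one.1 (show (T \ S).card = 1 by omega)
  have ha' : ∀ i, i ∈ S ∧ i ∉ T ↔ i = a := fun i => by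
    rw [← Finset.mem_sdiff, ha, Finset.mem_singleton]
  have hb' : ∀ i, i ∈ T ∧ i ∉ S ↔ i = b := fun i => by
    rw [← Finset.mem_sdiff, hb, Finset.mem_singleton]
  have haa := (ha' a).2 rfl
  have hbb := (hb' b).2 rfl
  refine ⟨a, b, haa.1, haa.2, hbb.1, hbb.2, fun i => ⟨fun hi => ⟨?_, ?_⟩, ?_⟩⟩
  · by_cases hiS : i ∈ S
    exacts [.inl hiS, .inr ((hb' i).1 ⟨hi, hiS⟩)]
  · rintro rfl; exact haa.2 hi
  · rintro ⟨hi | rfl, hne⟩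
    · by_contra hiT
      exact hne ((ha' i).1 ⟨hi, hiT⟩)
    · exact hbb.1

variable {d N : ℕ} {ε : ℤ}

lemma not_congr_succ (hN : 2 ≤ N) (s : ℤ) : ¬ congrSetoid N s (s + 1) := fun h => by
  rw [congrSetoid_iff, add_sub_cancel_left] at h
  have := Int.le_of_dvd one_pos h; omega

lemma not_congr_pred (hN : 2 ≤ N) (s : ℤ) : ¬ congrSetoid N s (s - 1) := fun h => by
  have h2 := not_congr_succ hN (s - 1)
  rw [sub_add_cancel] at h2
  exact h2 ((congrSetoid N).symm h)

lemma IsHoleSeq.mem_range_iff (hn : 0 < d + N) {h : ℤ → ℤ} (hh : IsHoleSeq d N ε h) (v : ℤ) :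
    (∃ t, h t = v) ↔ ∃ i ∉ holeFree d N h, (d + N : ℤ) ∣ v - (i : ℕ) := by
  have hn' : (0 : ℤ) < (d : ℤ) + N := by omega
  constructor
  · rintro ⟨t, rfl⟩
    have b1 := Int.emod_nonneg (h t) hn'.ne'
    have b2 := Int.emod_lt_of_pos (h t) hn'
    have e1 := Int.emod_add_mul_ediv (h t) (d + N)
    have hcast : (((h t % (d + N)).toNat : ℕ) : ℤ) = h t % (d + N) := by omega
    refine ⟨⟨(h t % (d + N)).toNat, by omega⟩, notMem_holeFree.2
      ⟨t + (-(h t / (d + N))) * N, ?_⟩, h t / (d + N), ?_⟩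
    · rw [hh.add_mul_period]
      simp only [hcast]; linarith
    · simp only [hcast]; linarith
  · rintro ⟨i, hi, k, hk⟩
    obtain ⟨t, ht⟩ := notMem_holeFree.1 hi
    exact ⟨t + k * N, by rw [hh.add_mul_period, ht]; linarith⟩

lemma IsHoleSeq.congr_of_dvd {h : ℤ → ℤ} (hh : IsHoleSeq d N ε h) {s t : ℤ}
    (hst : (d + N : ℤ) ∣ h t - h s) : congrSetoid N s t := by
  obtain ⟨k, hk⟩ := hst
  have h1 := hh.add_mul_period s k
  have : t = s + k * N := hh.strictMono.injective (by rw [h1]; linarith)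
  exact ⟨k, by rw [this]; ring⟩

/-- The sequences share the holes `s ± 1`, and `s` is the only index at which `g` can take a value
strictly between them. -/
lemma IsHoleSeq.eq_of_mem_range (hN : 2 ≤ N) {x g : ℤ → ℤ} (hx : IsHoleSeq d N ε x)
    (hg : IsHoleSeq d N ε g) {s t : ℤ} (h : AgreeOff (congrSetoid N) s g x) (ht : g t = x s) :
    g s = x s := by
  have h1 := h _ (not_congr_succ hN s)
  have h2 := h _ (not_congr_pred hN s)
  have h3 := hx.lt_succ s
  have h4 := hx.lt_succ (s - 1)
  rw [sub_add_cancel] at h4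
  have h5 : t < s + 1 := hg.strictMono.lt_iff_lt.1 (by omega)
  have h6 : s - 1 < t := hg.strictMono.lt_iff_lt.1 (by omega)
  rw [← ht, show t = s by omega]

lemma IsHoleSeq.mem_range_of_holeFree_eq (hn : 0 < d + N) {x y : ℤ → ℤ}
    (hx : IsHoleSeq d N ε x) (hy : IsHoleSeq d N ε y) (h : holeFree d N x = holeFree d N y)
    (t : ℤ) : ∃ u, y u = x t := by
  rw [hy.mem_range_iff hn, ← h, ← hx.mem_range_iff hn]
  exact ⟨t, rfl⟩

lemma IsHoleSeq.eq_of_eq {x g : ℤ → ℤ} (hx : IsHoleSeq d N ε x) (hg : IsHoleSeq d N ε g) {s : ℤ}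
    (h : AgreeOff (congrSetoid N) s g x) (hs : g s = x s) : g = x := by
  funext u
  by_cases hu : congrSetoid N s u
  · have := hx.apply_of_congr hg hu; omega
  · exact h u hu

/-- Two neighbours of a hole sequence are determined by their facets. -/
lemma IsHoleSeq.eq_of_holeFree_eq (hN : 2 ≤ N) {x y g : ℤ → ℤ} (hx : IsHoleSeq d N ε x)
    (hy : IsHoleSeq d N ε y) (hg : IsHoleSeq d N ε g) {s s' : ℤ}
    (h : AgreeOff (congrSetoid N) s g x) (h' : AgreeOff (congrSetoid N) s' g y)
    (hgx : g s ≠ x s) (hxy : holeFree d N x = holeFree d N y) : x = y := by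
  by_cases hss : congrSetoid N s s'
  · have hyx : AgreeOff (congrSetoid N) s y x := fun u hu =>
      (h' u fun h => hu ((congrSetoid N).trans hss h)).symm.trans (h u hu)
    obtain ⟨t, ht⟩ := hx.mem_range_of_holeFree_eq (by omega) hy hxy s
    exact (hx.eq_of_eq hy hyx (hx.eq_of_mem_range hN hy hyx ht)).symm
  · obtain ⟨t, ht⟩ := hy.mem_range_of_holeFree_eq (by omega) hx hxy.symm s
    rw [← h' s fun h => hss ((congrSetoid N).symm h)] at ht
    exact absurd (hg.eq_of_mem_range hN hx h.symm ht).symm hgx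

lemma IsHoleSeq.facetAdj (hN : 2 ≤ N) {x g : ℤ → ℤ} (hx : IsHoleSeq d N ε x)
    (hg : IsHoleSeq d N ε g) {s : ℤ} (h : AgreeOff (congrSetoid N) s g x) (hgx : g s ≠ x s) :
    FacetAdj d (holeFree d N g) (holeFree d N x) := by
  obtain ⟨i, hi, hdvd⟩ := (hx.mem_range_iff (by omega) (x s)).1 ⟨s, rfl⟩
  refine facetAdj_of_erase_subset (hg.isCyclicFacet (by omega)).1
    (hx.isCyclicFacet (by omega)).1 (fun heq => ?_) (a := i) fun j hj => ?_
  · obtain ⟨t, ht⟩ := hx.mem_range_of_holeFree_eq (by omega) hg heq.symm s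
    exact hgx (hx.eq_of_mem_range hN hg h ht)
  · obtain ⟨hji, hj⟩ := Finset.mem_erase.1 hj
    by_contra hjx
    obtain ⟨t, ht⟩ := notMem_holeFree.1 hjx
    by_cases hst : congrSetoid N s t
    · obtain ⟨k, hk⟩ := hst
      have h1 := hx.add_mul_period s k
      rw [show s + k * N = t by linarith, ht] at h1
      apply hji
      have h2 : (d + N : ℤ) ∣ (j : ℕ) - (i : ℕ) := by
        rw [show ((j : ℕ) : ℤ) - (i : ℕ) = (x s - (i : ℕ)) + k * (d + N) by linarith]
        exact dvd_add hdvd (Dvd.intro_left k rfl)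
      have h3 := Int.eq_zero_of_abs_lt_dvd h2 (by rw [abs_lt]; omega)
      exact Fin.ext (by omega)
    · rw [← h t hst] at ht
      exact mem_holeFree.1 hj t ht

lemma IsHoleSeq.mem_holeFree_moveHole (hN : 2 ≤ N) {h : ℤ → ℤ} (hh : IsHoleSeq d N ε h) {s q : ℤ}
    (i : Fin (d + N)) : i ∈ holeFree d N (_root_.moveHole d N h s q) ↔
      (i ∈ holeFree d N h ∨ (d + N : ℤ) ∣ (i : ℕ) - h s) ∧ ¬ (d + N : ℤ) ∣ (i : ℕ) - q := by
  have hN0 : (N : ℤ) ≠ 0 := by omega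
  rw [← not_iff_not, notMem_holeFree, not_and_or, not_not, not_or, notMem_holeFree]
  constructor
  · rintro ⟨t, ht⟩
    by_cases hst : congrSetoid N s t
    · right
      rw [_root_.moveHole, if_pos (congrSetoid_iff.1 hst)] at ht
      exact ⟨(t - s) / N, by linarith⟩
    · left
      rw [moveHole_of_not _ _ hst] at ht
      exact ⟨⟨t, ht⟩, fun hd => hst (hh.congr_of_dvd (by rwa [ht]))⟩
  · rintro (⟨⟨t, ht⟩, hnd⟩ | ⟨k, hk⟩)
    · refine ⟨t, ?_⟩
      rw [moveHole_of_not, ht]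
      rintro ⟨k, hk⟩
      refine hnd ⟨k, ?_⟩
      have := hh.add_mul_period s k
      rw [← ht, show t = s + k * N by linarith, this]; ring
    · refine ⟨s + k * N, ?_⟩
      simp only [_root_.moveHole, add_sub_cancel_left, dvd_mul_left, if_true,
        Int.mul_ediv_cancel _ hN0]
      linarith

/-- Alternation of colours in terms of the facet alone, usable before a hole sequence compatible
with a given one has been chosen. -/
lemma IsCyclicFacet.odd_of_consecutive (hN : 0 < N) {S : Finset (Fin (d + N))}
    (hS : IsCyclicFacet d S) {x y : ℤ} (hxy : x < y)
    (hx : ∃ i ∉ S, (d + N : ℤ) ∣ x - (i : ℕ)) (hy : ∃ i ∉ S, (d + N : ℤ) ∣ y - (i : ℕ))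
    (hno : ∀ v, x < v → v < y → ¬ ∃ i ∉ S, (d + N : ℤ) ∣ v - (i : ℕ)) :
    (colourPos d N x + colourPos d N y) % 2 = 1 := by
  obtain ⟨ε, h, hh, rfl⟩ := hS.exists_isHoleSeq hN
  rw [← hh.mem_range_iff (by omega)] at hx hy
  obtain ⟨t, rfl⟩ := hx
  obtain ⟨u, rfl⟩ := hy
  have htu := hh.strictMono.lt_iff_lt.1 hxy
  have : u = t + 1 := by
    by_contra hne
    exact hno (h (t + 1)) (hh.lt_succ t) (hh.strictMono (by omega))
      ((hh.mem_range_iff (by omega) _).1 ⟨_, rfl⟩)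
  subst this
  have h1 := hh.parity t
  have h2 := hh.parity (t + 1)
  omega

/-- Adjacent facets have neighbouring hole sequences. -/
lemma IsHoleSeq.exists_lift (hN : 2 ≤ N) {h : ℤ → ℤ} (hh : IsHoleSeq d N ε h)
    {T : Finset (Fin (d + N))} (hT : IsCyclicFacet d T) (hadj : FacetAdj d (holeFree d N h) T) :
    ∃ s h', IsHoleSeq d N ε h' ∧ AgreeOff (congrSetoid N) s h h' ∧ holeFree d N h' = T := by
  have hn : 0 < d + N := by omega
  have hn' : (0 : ℤ) < (d : ℤ) + N := by omega
  obtain ⟨a, b, haS, haT, hbT, hbS, hT'⟩ :=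
    hadj.exists_exchange (hh.isCyclicFacet (by omega)).1 hT.1
  obtain ⟨s, hs⟩ := notMem_holeFree.1 hbS
  have hdvd : ∀ i j : Fin (d + N), (d + N : ℤ) ∣ (i : ℕ) - (j : ℕ) → i = j := fun i j hij => by
    have h3 := Int.eq_zero_of_abs_lt_dvd hij (by rw [abs_lt]; omega)
    exact Fin.ext (by omega)
  have hold : ∀ u, ¬ congrSetoid N s u → ∃ i ∉ T, (d + N : ℤ) ∣ h u - (i : ℕ) := fun u hu => by
    obtain ⟨i, hi, hi'⟩ := (hh.mem_range_iff hn (h u)).1 ⟨u, rfl⟩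
    refine ⟨i, fun hiT => ?_, hi'⟩
    rcases ((hT' i).1 hiT).1 with h1 | rfl
    · exact hi h1
    · exact hu (hh.congr_of_dvd (by rwa [hs]))
  have hnew : ∀ k : ℤ, ∃ i ∉ T, (d + N : ℤ) ∣ (a : ℕ) + k * (d + N) - (i : ℕ) := fun k =>
    ⟨a, haT, k, by ring⟩
  have hno : ∀ u k : ℤ, h u < (a : ℕ) + k * (d + N) → (a : ℕ) + k * (d + N) < h (u + 1) →
      ∀ v, h u < v → v < h (u + 1) → v ≠ (a : ℕ) + k * (d + N) →
        ¬ ∃ i ∉ T, (d + N : ℤ) ∣ v - (i : ℕ) := by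
    rintro u k hl hr v hvl hvr hva ⟨i, hiT, hi⟩
    by_cases hia : i = a
    · subst hia
      obtain ⟨m, hm⟩ := hi
      have hp1 := hh.add_period u
      have hp2 := hh.add_period (u + 1 - N)
      rw [sub_add_cancel] at hp2
      have hm1 := hh.strictMono.monotone (show u + 1 ≤ u + N by omega)
      have hm2 := hh.strictMono.monotone (show u + 1 - N ≤ u by omega)
      have hv : v = (i : ℕ) + k * (d + N) + (m - k) * (d + N) := by linarith
      rcases lt_trichotomy m k with hmk | rfl | hmk
      · have : (m - k) * ((d : ℤ) + N) ≤ -1 * (d + N) :=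
          mul_le_mul_of_nonneg_right (by omega) (by omega)
        omega
      · exact hva (by rw [hv]; ring)
      · have : 1 * ((d : ℤ) + N) ≤ (m - k) * (d + N) :=
          mul_le_mul_of_nonneg_right (by omega) (by omega)
        omega
    · obtain ⟨t, ht⟩ := (hh.mem_range_iff hn v).2
        ⟨i, fun hiS => hiT ((hT' i).2 ⟨.inl hiS, hia⟩), hi⟩
      have h1 := hh.strictMono.lt_iff_lt.1 (ht ▸ hvl)
      have h2 := hh.strictMono.lt_iff_lt.1 (ht ▸ hvr)
      omega
  have hright : ∀ u k : ℤ, h u < (a : ℕ) + k * (d + N) → (a : ℕ) + k * (d + N) < h (u + 1) →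
      ¬ congrSetoid N s (u + 1) →
      (colourPos d N ((a : ℕ) + k * (d + N)) + colourPos d N (h (u + 1))) % 2 = 1 :=
    fun u k hl hr hu => hT.odd_of_consecutive (by omega) hr (hnew k) (hold _ hu)
      fun v h1 h2 => hno u k hl hr v (by omega) h2 (by omega)
  have hleft : ∀ u k : ℤ, h u < (a : ℕ) + k * (d + N) → (a : ℕ) + k * (d + N) < h (u + 1) →
      ¬ congrSetoid N s u →
      (colourPos d N (h u) + colourPos d N ((a : ℕ) + k * (d + N))) % 2 = 1 :=
    fun u k hl hr hu => hT.odd_of_consecutive (by omega) hl (hold _ hu) (hnew k)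
      fun v h1 h2 => hno u k hl hr v h1 (by omega) (by omega)
  -- Locate the new hole `a` between consecutive old holes. If neither were a translate of the
  -- removed hole, `a` would need the colour opposite to both, but these have opposite colours. So
  -- some translate of `a` lies between holes `s - 1` and `s + 1`, and the neighbour that remains
  -- fixes its colour.
  have key : ∃ k : ℤ, h (s - 1) < (a : ℕ) + k * (d + N) ∧ (a : ℕ) + k * (d + N) < h (s + 1) ∧
      (colourPos d N ((a : ℕ) + k * (d + N)) + s + ε) % 2 = 0 := by
    have hs1 := hh.lt_succ (s - 1)
    rw [sub_add_cancel] at hs1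
    obtain ⟨u, hu1, hu2⟩ := hh.exists_between (a : ℕ)
    have hu1' : h u < (a : ℕ) := lt_of_le_of_ne hu1 (mem_holeFree.1 haS u)
    by_cases c1 : congrSetoid N s u
    · obtain ⟨k, hk⟩ := c1
      obtain rfl : u = s + k * N := by linarith
      rw [hh.add_mul_period] at hu1'
      rw [show s + k * N + 1 = s + 1 + k * N by ring, hh.add_mul_period] at hu2
      have h1 := hright s (-k) (by linarith) (by linarith) (not_congr_succ hN s)
      have h2 := hh.parity (s + 1)
      exact ⟨-k, by linarith, by linarith, by omega⟩
    · by_cases c2 : congrSetoid N s (u + 1)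
      · obtain ⟨k, hk⟩ := c2
        obtain rfl : u = s - 1 + k * N := by linarith
        rw [hh.add_mul_period] at hu1'
        rw [show s - 1 + k * N + 1 = s + k * N by ring, hh.add_mul_period] at hu2
        have h1 := hleft (s - 1) (-k) (by linarith) (by rw [sub_add_cancel]; linarith)
          (not_congr_pred hN s)
        have h2 := hh.parity (s - 1)
        have h3 := hh.lt_succ s
        exact ⟨-k, by linarith, by linarith, by omega⟩
      · have h1 := hleft u 0 (by linarith) (by linarith) c1
        have h2 := hright u 0 (by linarith) (by linarith) c2
        have h3 := hh.parity u
        have h4 := hh.parity (u + 1)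
        omega
  obtain ⟨k, hk1, hk2, hk3⟩ := key
  refine ⟨s, _, hh.moveHole hN hk1 hk2 hk3, agreeOff_moveHole _ _ _, ?_⟩
  ext i
  rw [hh.mem_holeFree_moveHole hN, hT' i, hs]
  refine and_congr (or_congr Iff.rfl ⟨hdvd i b, ?_⟩) (not_congr ⟨fun h1 => hdvd i a ?_, ?_⟩)
  · rintro rfl; simp
  · have := dvd_add h1 (Dvd.intro_left k rfl)
    rwa [show ((i : ℕ) : ℤ) - ((a : ℕ) + k * (d + N)) + k * (d + N) = (i : ℕ) - (a : ℕ) by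
      ring] at this
  · rintro rfl; exact ⟨-k, by ring⟩

end FacetGraph

/-! ### A common hole of the facets outside the family -/

section CommonHole

/-- A set of facets each of whose members has exactly one neighbour outside, such that the
facets outside are connected to each other. -/
structure IsPerlesFamily (d : ℕ) {n : ℕ} (H : Set (Finset (Fin n))) : Prop where
  isCyclicFacet : ∀ S ∈ H, IsCyclicFacet d S
  nonempty : H.Nonempty
  exists_exit : ∀ S ∈ H, ∃ T, IsCyclicFacet d T ∧ T ∉ H ∧ FacetAdj d S T
  exit_unique : ∀ S ∈ H, ∀ T T', IsCyclicFacet d T → T ∉ H → FacetAdj d S T →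
    IsCyclicFacet d T' → T' ∉ H → FacetAdj d S T' → T = T'
  connected : ∀ S T, IsCyclicFacet d S → S ∉ H → IsCyclicFacet d T → T ∉ H →
    Relation.ReflTransGen (fun A B => IsCyclicFacet d B ∧ B ∉ H ∧ FacetAdj d A B) S T

variable {d N : ℕ} {ε : ℤ}

/-- The hole that moves on entering `H` is frozen along all walks outside `H`. Its residue is the
required `i`: a hole of every outside facet, but an element of the facet of `g`, from which it has
moved away. -/
lemma IsPerlesFamily.exists_common_hole_of_move (hd : 2 ≤ d) (hN : 2 ≤ N)
    {H : Set (Finset (Fin (d + N)))} (hH : IsPerlesFamily d H) {z g : ℤ → ℤ} {s : ℤ}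
    (hz : IsHoleSeq d N ε z) (hzH : holeFree d N z ∉ H) (hg : IsHoleSeq d N ε g)
    (hgH : holeFree d N g ∈ H) (hzg : AgreeOff (congrSetoid N) s z g)
    (hcap : 4 ≤ d ∨ g s = z s + 1 ∨ z s = g s + 1) :
    ∃ i, (∃ S ∈ H, i ∈ S) ∧ ∀ T, IsCyclicFacet d T → T ∉ H → i ∉ T := by
  set W : Set (ℤ → ℤ) := {h | IsHoleSeq d N ε h ∧ holeFree d N h ∉ H} with hW
  have hU : UniqueExit (congrSetoid N) {h | IsHoleSeq d N ε h} W := by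
    refine uniqueExit_isHoleSeq (fun h hh => hh.1) fun g hg hgW x hx y hy s s' h1 h2 => ?_
    have hgH : holeFree d N g ∈ H := by
      by_contra h; exact hgW ⟨hg, h⟩
    have hgx : g s ≠ x s := fun h => hgW (hx.1.eq_of_eq hg h1 h ▸ hx)
    have hgy : g s' ≠ y s' := fun h => hgW (hy.1.eq_of_eq hg h2 h ▸ hy)
    refine hx.1.eq_of_holeFree_eq hN hy.1 hg h1 h2 hgx ?_
    exact hH.exit_unique _ hgH _ _ (hx.1.isCyclicFacet (by omega)) hx.2
      (hx.1.facetAdj hN hg h1 hgx) (hy.1.isCyclicFacet (by omega)) hy.2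
      (hy.1.facetAdj hN hg h2 hgy)
  have hne : z s ≠ g s := fun h => hzH (by rw [hg.eq_of_eq hz hzg h]; exact hgH)
  obtain ⟨i, hiz, hi⟩ := (hz.mem_range_iff (by omega) (z s)).1 ⟨s, rfl⟩
  refine ⟨i, ⟨_, hgH, ?_⟩, fun T hT hTH => ?_⟩
  · by_contra hig
    obtain ⟨t, ht⟩ := (hg.mem_range_iff (by omega) (z s)).2 ⟨i, hig, hi⟩
    exact hne (hz.eq_of_mem_range hN hg hzg.symm ht).symm
  · have hwalk : ∃ x, Relation.ReflTransGen (WStep (congrSetoid N) W) z x ∧ x ∈ W ∧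
        holeFree d N x = T := by
      have := hH.connected _ T (hz.isCyclicFacet (by omega)) hzH hT hTH
      clear hT hTH
      induction this with
      | refl => exact ⟨z, .refl, ⟨hz, hzH⟩, rfl⟩
      | @tail A B _ hAB ih =>
        obtain ⟨x, hzx, hx, rfl⟩ := ih
        obtain ⟨s', y, hy, hxy, rfl⟩ := hx.1.exists_lift hN hAB.1 hAB.2.2
        exact ⟨y, hzx.tail ⟨hx, ⟨hy, hAB.2.1⟩, s', hxy⟩, ⟨hy, hAB.2.1⟩, rfl⟩
    obtain ⟨x, hzx, hx, rfl⟩ := hwalk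
    have hxs := hU.apply_eq hd hN ⟨hz, hzH⟩ hg (fun h => h.2 hgH) hzg hne hcap hzx
    obtain ⟨j, hjx, hj⟩ := (hx.1.mem_range_iff (by omega) (x s)).1 ⟨s, rfl⟩
    have : i = j := by
      rw [hxs] at hj
      have h1 := dvd_sub hj hi
      have h2 := Int.eq_zero_of_abs_lt_dvd h1 (by rw [abs_lt]; omega)
      exact Fin.ext (by omega)
    rwa [this]

lemma IsPerlesFamily.exists_common_hole_of_four_le (hd : 4 ≤ d) (hN : 2 ≤ N)
    {H : Set (Finset (Fin (d + N)))} (hH : IsPerlesFamily d H) :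
    ∃ i, (∃ S ∈ H, i ∈ S) ∧ ∀ T, IsCyclicFacet d T → T ∉ H → i ∉ T := by
  obtain ⟨S, hS⟩ := hH.nonempty
  obtain ⟨Z, hZ, hZH, hSZ⟩ := hH.exists_exit S hS
  obtain ⟨ε, z, hz, rfl⟩ := hZ.exists_isHoleSeq (by omega)
  obtain ⟨s, g, hg, hzg, rfl⟩ := hz.exists_lift hN (hH.isCyclicFacet S hS) hSZ.symm
  exact hH.exists_common_hole_of_move (by omega) hN hz hZH hg hS hzg (.inl hd)

/-- Any two facets of a simplex are adjacent, so a member of `H` has all outside facets as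
neighbours, and there is only one. -/
lemma IsPerlesFamily.exists_common_hole_of_simplex {H : Set (Finset (Fin (d + 1)))}
    (hH : IsPerlesFamily d H) :
    ∃ i, (∃ S ∈ H, i ∈ S) ∧ ∀ T, IsCyclicFacet d T → T ∉ H → i ∉ T := by
  obtain ⟨S, hS⟩ := hH.nonempty
  obtain ⟨Z, hZ, hZH, hSZ⟩ := hH.exists_exit S hS
  obtain ⟨b, a, hb, -, ha, haS, -⟩ := hSZ.symm.exists_exchange hZ.1 (hH.isCyclicFacet S hS).1
  refine ⟨a, ⟨S, hS, ha⟩, fun T hT hTH => ?_⟩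
  have hadj : FacetAdj d S T := by
    have hne : S ≠ T := fun h => hTH (h ▸ hS)
    have h1 := Finset.card_union_add_card_inter S T
    have h2 : (S ∪ T).card ≤ d + 1 := by simpa using Finset.card_le_univ (S ∪ T)
    have hSc := (hH.isCyclicFacet S hS).1
    have hTc := hT.1
    refine ⟨hne, ?_⟩
    have h4 : (S ∩ T).card < S.card := by
      refine Finset.card_lt_card ⟨Finset.inter_subset_left, fun h5 => hne ?_⟩
      exact Finset.eq_of_subset_of_card_le (h5.trans Finset.inter_subset_right) (by omega)
    omega
  rw [hH.exit_unique S hS T Z hT hTH hadj hZ hZH hSZ]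
  exact haS

lemma IsPerlesFamily.exists_common_hole_of_one {n : ℕ} {H : Set (Finset (Fin n))}
    (hH : IsPerlesFamily 1 H) :
    ∃ i, (∃ S ∈ H, i ∈ S) ∧ ∀ T, IsCyclicFacet 1 T → T ∉ H → i ∉ T := by
  obtain ⟨S, hS⟩ := hH.nonempty
  obtain ⟨i, rfl⟩ := Finset.card_eq_one.1 (hH.isCyclicFacet S hS).1
  refine ⟨i, ⟨_, hS, Finset.mem_singleton_self i⟩, fun T hT hTH hi => hTH ?_⟩
  obtain ⟨j, rfl⟩ := Finset.card_eq_one.1 hT.1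
  rwa [← Finset.mem_singleton.1 hi]

/-- An edge in `H` has two neighbours, of which only one is outside. It shares a vertex with the
other, and these two edges are the whole star of that vertex. -/
lemma IsPerlesFamily.exists_common_hole_of_two {n : ℕ} {H : Set (Finset (Fin n))}
    (hH : IsPerlesFamily 2 H)
    (hridge : ∀ S : Finset (Fin n), IsCyclicFacet 2 S → ∀ a ∈ S,
      ∃! T, IsCyclicFacet 2 T ∧ T ≠ S ∧ S.erase a ⊆ T) :
    ∃ i, (∃ S ∈ H, i ∈ S) ∧ ∀ T, IsCyclicFacet 2 T → T ∉ H → i ∉ T := by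
  obtain ⟨S, hS⟩ := hH.nonempty
  have hSf := hH.isCyclicFacet S hS
  have hex : ∃ a ∈ S, ∃ T ∈ H, T ≠ S ∧ S.erase a ⊆ T := by
    by_contra! hno
    obtain ⟨a, b, hab, rfl⟩ := Finset.card_eq_two.1 hSf.1
    obtain ⟨T, ⟨hT, hTS, hTa⟩, -⟩ := hridge _ hSf a (by simp)
    obtain ⟨U, ⟨hU, hUS, hUb⟩, -⟩ := hridge _ hSf b (by simp)
    have hTH : T ∉ H := fun h => hno a (by simp) T h hTS hTa
    have hUH : U ∉ H := fun h => hno b (by simp) U h hUS hUb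
    have := hH.exit_unique _ hS T U hT hTH (facetAdj_of_erase_subset hSf.1 hT.1 hTS.symm hTa)
      hU hUH (facetAdj_of_erase_subset hSf.1 hU.1 hUS.symm hUb)
    subst this
    have hsub : {a, b} ⊆ T := by
      intro i hi
      by_cases hia : i = a
      · exact hUb (by rw [hia, Finset.mem_erase]; simp [hab])
      · exact hTa (Finset.mem_erase.2 ⟨hia, hi⟩)
    exact hTS (Finset.eq_of_subset_of_card_le hsub (by rw [hSf.1, hT.1])).symm
  obtain ⟨a, ha, T, hT, hTS, hTa⟩ := hex
  have hc : (S.erase a).card = 1 := by rw [Finset.card_erase_of_mem ha, hSf.1]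
  obtain ⟨i, hi⟩ := Finset.card_eq_one.1 hc
  have hiS : i ∈ S := Finset.mem_of_mem_erase (a := a) (by rw [hi]; simp)
  refine ⟨i, ⟨S, hS, hiS⟩, fun U hU hUH hiU => hUH ?_⟩
  have := (hridge S hSf a ha).unique (y₁ := U) (y₂ := T)
    ⟨hU, fun h => hUH (h ▸ hS), by rw [hi]; simpa using hiU⟩
    ⟨hH.isCyclicFacet T hT, hTS, hTa⟩
  rwa [this]

end CommonHole

/-! ### Dimension three, and the conclusion for all dimensions -/

section DimensionThree

variable {n : ℕ}

/-- The triangle with vertices `x`, `y`, `z`. -/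
def natTriangle (n x y z : ℕ) : Finset (Fin n) :=
  Finset.univ.filter fun i => (i : ℕ) = x ∨ (i : ℕ) = y ∨ (i : ℕ) = z

lemma mem_natTriangle {x y z : ℕ} {i : Fin n} :
    i ∈ natTriangle n x y z ↔ (i : ℕ) = x ∨ (i : ℕ) = y ∨ (i : ℕ) = z := by
  simp [natTriangle]

lemma natTriangle_eq {x y z : ℕ} (hx : x < n) (hy : y < n) (hz : z < n) :
    natTriangle n x y z = {⟨x, hx⟩, ⟨y, hy⟩, ⟨z, hz⟩} := by
  ext i; simp [mem_natTriangle, Fin.ext_iff]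

lemma card_natTriangle {x y z : ℕ} (hxy : x < y) (hyz : y < z) (hz : z < n) :
    (natTriangle n x y z).card = 3 := by
  rw [natTriangle_eq (by omega) (by omega) hz]
  refine Finset.card_eq_three.2 ⟨_, _, _, ?_, ?_, ?_, rfl⟩ <;> simp <;> omega

lemma card_filter_natTriangle {x y z : ℕ} (hxy : x < y) (hyz : y < z) (hz : z < n) (j : Fin n) :
    ((natTriangle n x y z).filter (· < j)).card =
      (if x < j then 1 else 0) + (if y < j then 1 else 0) + (if z < j then 1 else 0) := by
  rw [natTriangle_eq (by omega) (by omega) hz, Finset.card_filter, Finset.sum_insert,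
    Finset.sum_insert, Finset.sum_singleton]
  · simp only [Fin.lt_def, add_assoc]
  · simp; omega
  · simp; omega

/-- With odd Gale parity neither `0` nor `y + 1` can be a hole; with even parity neither `x + 1` nor
a position `z + 1 < n` can. -/
lemma isCyclicFacet_natTriangle_iff {x y z : ℕ} (hxy : x < y) (hyz : y < z) (hz : z < n) :
    IsCyclicFacet 3 (natTriangle n x y z) ↔
      (x = 0 ∧ z = y + 1) ∨ (y = x + 1 ∧ z + 1 = n) := by
  simp only [IsCyclicFacet, card_natTriangle hxy hyz hz, true_and, IsGale,
    card_filter_natTriangle hxy hyz hz, mem_natTriangle]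
  constructor
  · rintro ⟨e, he⟩
    by_contra! hc
    have h0 : e = 1 → x = 0 ∧ z = y + 1 := by
      rintro rfl
      constructor
      · by_contra hx0
        have := he ⟨0, by omega⟩ (by simp; omega)
        simp at this
      · by_contra hzy
        have := he ⟨y + 1, by omega⟩ (by simp; omega)
        rw [if_pos (by simp; omega), if_pos (by simp), if_neg (by simp; omega)] at this
        omega
    have h1 : e ≠ 1 → y = x + 1 ∧ z + 1 = n := by
      intro hne
      constructor
      · by_contra hyx
        have := he ⟨x + 1, by omega⟩ (by simp; omega)
        rw [if_pos (by simp), if_neg (by simp; omega), if_neg (by simp; omega)] at this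
        omega
      · by_contra hzn
        have := he ⟨z + 1, by omega⟩ (by simp; omega)
        rw [if_pos (by simp; omega), if_pos (by simp; omega), if_pos (by simp)] at this
        omega
    by_cases h : e = 1
    · have := h0 h; omega
    · have := h1 h; omega
  · rintro (⟨rfl, rfl⟩ | ⟨rfl, hz'⟩)
    · refine ⟨1, fun j hj => ?_⟩
      split_ifs <;> omega
    · refine ⟨0, fun j hj => ?_⟩
      split_ifs <;> omega

lemma IsCyclicFacet.eq_natTriangle {S : Finset (Fin n)} (hS : IsCyclicFacet 3 S) :
    ∃ c, (1 ≤ c ∧ c + 1 < n ∧ S = natTriangle n 0 c (c + 1)) ∨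
      (c + 2 < n ∧ S = natTriangle n c (c + 1) (n - 1)) := by
  set e := S.orderEmbOfFin hS.1
  have hmem : ∀ i, i ∈ S ↔ i = e 0 ∨ i = e 1 ∨ i = e 2 := fun i => by
    rw [← Finset.mem_coe, ← Finset.range_orderEmbOfFin S hS.1, Set.mem_range]
    constructor
    · rintro ⟨k, rfl⟩
      fin_cases k <;> simp [e]
    · rintro (rfl | rfl | rfl) <;> exact ⟨_, rfl⟩
  have h01 : (e 0 : ℕ) < e 1 := by exact_mod_cast Fin.lt_def.1 (e.strictMono (by simp))
  have h12 : (e 1 : ℕ) < e 2 := by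
    exact_mod_cast Fin.lt_def.1 (e.strictMono (show (1 : Fin 3) < 2 by decide))
  have hST : S = natTriangle n (e 0) (e 1) (e 2) := by
    ext i; rw [hmem, mem_natTriangle]; simp only [Fin.ext_iff]
  have h3 := (e 2).2
  rw [hST, isCyclicFacet_natTriangle_iff h01 h12 h3] at hS
  rcases hS with ⟨hx, hz⟩ | ⟨hy, hz⟩
  · exact ⟨e 1, .inl ⟨by omega, by omega, by rw [hST, hx, hz]⟩⟩
  · exact ⟨e 0, .inr ⟨by omega, by
      rw [hST, hy, show ((e 2 : Fin n) : ℕ) = n - 1 by omega]⟩⟩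

variable {N : ℕ}

/-- The two triangles on `{c, c + 1}` differ by moving the hole `n - 1` to `n`, a translate of `0`.
This crosses the seam by one position and keeps the colour as `d` is odd, so the freezing criterion
applies although `d < 4`. -/
lemma IsPerlesFamily.exists_common_hole_of_mixed (hN : 2 ≤ N) {H : Set (Finset (Fin (3 + N)))}
    (hH : IsPerlesFamily 3 H) {c : ℕ} (hc : 1 ≤ c) (hcN : c < 1 + N)
    (hmix : ¬ (natTriangle (3 + N) 0 c (c + 1) ∈ H ↔
      natTriangle (3 + N) c (c + 1) (3 + N - 1) ∈ H)) :
    ∃ i, (∃ S ∈ H, i ∈ S) ∧ ∀ T, IsCyclicFacet 3 T → T ∉ H → i ∉ T := by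
  have hA : IsCyclicFacet 3 (natTriangle (3 + N) 0 c (c + 1)) :=
    (isCyclicFacet_natTriangle_iff (by omega) (by omega) (by omega)).2 (.inl ⟨rfl, rfl⟩)
  have hB : IsCyclicFacet 3 (natTriangle (3 + N) c (c + 1) (3 + N - 1)) :=
    (isCyclicFacet_natTriangle_iff (by omega) (by omega) (by omega)).2 (.inr ⟨rfl, by omega⟩)
  obtain ⟨ε, z, hz, hzA⟩ := hA.exists_isHoleSeq (by omega)
  have h0 : ∀ t, z t ≠ 3 + N := fun t ht => by
    have h1 := hz.add_mul_period t (-1)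
    refine notMem_holeFree.2 ⟨t + -1 * N, ?_⟩ (show (⟨0, by omega⟩ : Fin (3 + N)) ∈ _ by
      rw [hzA, mem_natTriangle]; simp)
    rw [h1, ht]; push_cast; ring
  obtain ⟨s, hs⟩ := notMem_holeFree.1 (show (⟨3 + N - 1, by omega⟩ : Fin (3 + N)) ∉
    holeFree 3 N z by rw [hzA, mem_natTriangle]; simp; omega)
  have hs' : z s = 3 + N - 1 := by rw [hs]; simp; omega
  have hz1 := hz.lt_succ s
  have hz2 := h0 (s + 1)
  have hz3 := hz.lt_succ (s - 1)
  rw [sub_add_cancel] at hz3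
  have hpar := hz.parity s
  have hp := pos_succ (d := 3) (N := N) (by omega) (z s)
  have hp' := hp.resolve_right fun h => h.1 (by rw [hs']; simp)
  have hg := hz.moveHole hN (s := s) (q := z s + 1) (by omega) (by omega) (by omega)
  have hgB : holeFree 3 N (moveHole 3 N z s (z s + 1)) =
      natTriangle (3 + N) c (c + 1) (3 + N - 1) := by
    ext i
    rw [hz.mem_holeFree_moveHole hN, hzA, mem_natTriangle, mem_natTriangle, hs']
    have e1 : (((3 : ℕ) : ℤ) + N ∣ (i : ℕ) - (3 + N - 1)) ↔ (i : ℕ) = 3 + N - 1 := by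
      constructor
      · intro h
        have := Int.eq_zero_of_abs_lt_dvd h (by rw [abs_lt]; omega)
        omega
      · intro h
        rw [show ((i : ℕ) : ℤ) - (3 + N - 1) = 0 by omega]; exact dvd_zero _
    have e2 : (((3 : ℕ) : ℤ) + N ∣ (i : ℕ) - (3 + N - 1 + 1)) ↔ (i : ℕ) = 0 := by
      constructor
      · intro h
        have h' : ((3 : ℕ) : ℤ) + N ∣ ((i : ℕ) : ℤ) := by
          have := dvd_add h (dvd_refl (((3 : ℕ) : ℤ) + N))
          rwa [show ((i : ℕ) : ℤ) - (3 + N - 1 + 1) + (((3 : ℕ) : ℤ) + N) = (i : ℕ) by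
            push_cast; ring] at this
        have := Int.eq_zero_of_abs_lt_dvd h' (by rw [abs_lt]; omega)
        omega
      · intro h
        rw [h]; exact ⟨-1, by push_cast; ring⟩
    rw [e1, e2]
    omega
  by_cases hAH : natTriangle (3 + N) 0 c (c + 1) ∈ H
  · have hBH : natTriangle (3 + N) c (c + 1) (3 + N - 1) ∉ H := fun h => hmix (by tauto)
    refine hH.exists_common_hole_of_move (s := s) (by omega) hN hg (by rwa [hgB]) hz
      (by rwa [hzA]) (agreeOff_moveHole _ _ _).symm ?_
    rw [moveHole_self]; omega
  · have hBH : natTriangle (3 + N) c (c + 1) (3 + N - 1) ∈ H := by tauto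
    refine hH.exists_common_hole_of_move (s := s) (by omega) hN hz (by rwa [hzA]) hg
      (by rwa [hgB]) (agreeOff_moveHole _ _ _) ?_
    rw [moveHole_self]; omega

lemma IsPerlesFamily.exists_common_hole_of_three (hN : 2 ≤ N) {H : Set (Finset (Fin (3 + N)))}
    (hH : IsPerlesFamily 3 H) :
    ∃ i, (∃ S ∈ H, i ∈ S) ∧ ∀ T, IsCyclicFacet 3 T → T ∉ H → i ∉ T := by
  by_cases hmix : ∃ c, 1 ≤ c ∧ c < 1 + N ∧ ¬ (natTriangle (3 + N) 0 c (c + 1) ∈ H ↔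
      natTriangle (3 + N) c (c + 1) (3 + N - 1) ∈ H)
  · obtain ⟨c, h1, h2, h3⟩ := hmix
    exact hH.exists_common_hole_of_mixed hN h1 h2 h3
  push Not at hmix
  set A : ℕ → Finset (Fin (3 + N)) := fun c => natTriangle (3 + N) 0 c (c + 1) with hAdef
  set B : ℕ → Finset (Fin (3 + N)) := fun c => natTriangle (3 + N) c (c + 1) (3 + N - 1) with hBdef
  have hA : ∀ c, 1 ≤ c → c < 2 + N → IsCyclicFacet 3 (A c) := fun c h1 h2 =>
    (isCyclicFacet_natTriangle_iff (by omega) (by omega) (by omega)).2 (.inl ⟨rfl, rfl⟩)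
  have hB : ∀ c, c < 1 + N → IsCyclicFacet 3 (B c) := fun c h1 =>
    (isCyclicFacet_natTriangle_iff (by omega) (by omega) (by omega)).2 (.inr ⟨rfl, by omega⟩)
  have hmA : ∀ c (i : Fin (3 + N)), i ∈ A c ↔ (i : ℕ) = 0 ∨ (i : ℕ) = c ∨ (i : ℕ) = c + 1 :=
    fun c i => mem_natTriangle
  have hmB : ∀ c (i : Fin (3 + N)), i ∈ B c ↔
      (i : ℕ) = c ∨ (i : ℕ) = c + 1 ∨ (i : ℕ) = 3 + N - 1 := fun c i => mem_natTriangle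
  have hadj : ∀ {S T : Finset (Fin (3 + N))} (a v : ℕ), v < 3 + N → IsCyclicFacet 3 S →
      IsCyclicFacet 3 T → (∀ i : Fin (3 + N), (i : ℕ) = v → i ∈ T ∧ i ∉ S) →
      (∀ i : Fin (3 + N), i ∈ S → (i : ℕ) ≠ a → i ∈ T) → a < 3 + N → FacetAdj 3 S T := by
    intro S T a v hv hS hT h1 h2 ha
    refine facetAdj_of_erase_subset hS.1 hT.1 (fun h => ?_) (a := ⟨a, ha⟩) fun i hi => ?_
    · have := h1 ⟨v, hv⟩ rfl
      rw [h] at this; exact this.2 this.1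
    · rw [Finset.mem_erase] at hi
      exact h2 i hi.2 fun h => hi.1 (Fin.ext h)
  -- From here on `A c` and `B c` belong to `H` together whenever both are facets; `P c` says that
  -- those among the two that are facets lie in `H`.
  set P : ℕ → Prop := fun c => (1 ≤ c → A c ∈ H) ∧ (c < 1 + N → B c ∈ H) with hP
  have hPA : ∀ c, 1 ≤ c → A c ∈ H → P c := fun c h1 h2 =>
    ⟨fun _ => h2, fun h3 => (hmix c h1 h3).1 h2⟩
  have hPB : ∀ c, c < 1 + N → B c ∈ H → P c := fun c h1 h2 =>
    ⟨fun h3 => (hmix c h3 h1).2 h2, fun _ => h2⟩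
  -- The facets through the vertex `c + 1` are those of index `c` and `c + 1`, so the full star is
  -- in `H`.
  have hfin : ∀ c, c < 1 + N → P c → P (c + 1) →
      ∃ i, (∃ S ∈ H, i ∈ S) ∧ ∀ T, IsCyclicFacet 3 T → T ∉ H → i ∉ T := by
    intro c hc h1 h2
    refine ⟨⟨c + 1, by omega⟩, ⟨B c, h1.2 hc, (hmB _ _).2 (by simp)⟩, fun T hT hTH hi => hTH ?_⟩
    obtain ⟨e, ⟨he1, he2, rfl⟩ | ⟨he, rfl⟩⟩ := hT.eq_natTriangle
    · rw [mem_natTriangle] at hi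
      simp only at hi
      rcases (by omega : e = c + 1 ∨ e = c) with rfl | rfl
      · exact h2.1 he1
      · exact h1.1 he1
    · rw [mem_natTriangle] at hi
      simp only at hi
      rcases (by omega : e = c + 1 ∨ e = c) with rfl | rfl
      · exact h2.2 (by omega)
      · exact h1.2 (by omega)
  -- Of the neighbours of `A c` with index `c - 1` and `c + 1`, at most one is outside `H`; the
  -- lower one is `B 0` when `c = 1`.
  have hmid : ∀ c, 1 ≤ c → c < 1 + N → A c ∈ H →
      ∃ i, (∃ S ∈ H, i ∈ S) ∧ ∀ T, IsCyclicFacet 3 T → T ∉ H → i ∉ T := by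
    intro c hc hcN hcH
    have hr : FacetAdj 3 (A c) (A (c + 1)) := hadj c (c + 2) (by omega) (hA c hc (by omega))
      (hA (c + 1) (by omega) (by omega)) (fun i hi => by rw [hmA, hmA]; omega)
      (fun i => by rw [hmA, hmA]; omega) (by omega)
    by_cases hrH : A (c + 1) ∈ H
    · exact hfin c hcN (hPA c hc hcH) (hPA (c + 1) (by omega) hrH)
    rcases (by omega : c = 1 ∨ 2 ≤ c) with rfl | hc2
    · have hl : FacetAdj 3 (A 1) (B 0) := hadj 2 (2 + N) (by omega) (hA 1 hc (by omega))
        (hB 0 (by omega)) (fun i hi => by rw [hmA, hmB]; omega)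
        (fun i => by rw [hmA, hmB]; omega) (by omega)
      by_cases hlH : B 0 ∈ H
      · exact hfin 0 (by omega) (hPB 0 (by omega) hlH) (hPA 1 le_rfl hcH)
      have := hH.exit_unique _ hcH _ _ (hA (1 + 1) (by omega) (by omega)) hrH hr
        (hB 0 (by omega)) hlH hl
      have h1 := (hmA (1 + 1) ⟨3, by omega⟩).2 (by simp)
      rw [this, hmB] at h1
      simp only at h1; omega
    · have hl : FacetAdj 3 (A c) (A (c - 1)) := hadj (c + 1) (c - 1) (by omega)
        (hA c hc (by omega)) (hA (c - 1) (by omega) (by omega))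
        (fun i hi => by rw [hmA, hmA]; omega) (fun i => by rw [hmA, hmA]; omega) (by omega)
      by_cases hlH : A (c - 1) ∈ H
      · refine hfin (c - 1) (by omega) (hPA _ (by omega) hlH) ?_
        rw [show c - 1 + 1 = c by omega]; exact hPA c hc hcH
      have := hH.exit_unique _ hcH _ _ (hA (c + 1) (by omega) (by omega)) hrH hr
        (hA (c - 1) (by omega) (by omega)) hlH hl
      have h1 := (hmA (c + 1) ⟨c + 1, by omega⟩).2 (by simp)
      rw [this, hmA] at h1
      simp only at h1; omega
  obtain ⟨S, hS⟩ := hH.nonempty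
  obtain ⟨c, ⟨hc1, hc2, rfl⟩ | ⟨hc, rfl⟩⟩ := (hH.isCyclicFacet S hS).eq_natTriangle
  · rcases (by omega : c < 1 + N ∨ c = 1 + N) with hcN | rfl
    · exact hmid c hc1 hcN hS
    -- The last triangle has no partner, but is adjacent to both members of the pair of index `N`,
    -- which cannot both be exits. The triangle `B 0` is treated in the same way with the pair of
    -- index `1`.
    · change A (1 + N) ∈ H at hS
      have h1 : FacetAdj 3 (A (1 + N)) (A N) := hadj (2 + N) N (by omega)
        (hA _ (by omega) (by omega)) (hA _ (by omega) (by omega))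
        (fun i hi => by rw [hmA, hmA]; omega) (fun i => by rw [hmA, hmA]; omega) (by omega)
      have h2 : FacetAdj 3 (A (1 + N)) (B N) := hadj 0 N (by omega)
        (hA _ (by omega) (by omega)) (hB _ (by omega))
        (fun i hi => by rw [hmA, hmB]; omega) (fun i => by rw [hmA, hmB]; omega) (by omega)
      have hNH : A N ∈ H := by
        by_contra hNH
        have hBH : B N ∉ H := fun h => hNH ((hmix N (by omega) (by omega)).2 h)
        have := hH.exit_unique _ hS _ _ (hA N (by omega) (by omega)) hNH h1
          (hB N (by omega)) hBH h2
        have h3 := (hmA N ⟨0, by omega⟩).2 (by simp)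
        rw [this, hmB] at h3
        simp only at h3; omega
      exact hmid N (by omega) (by omega) hNH
  · change B c ∈ H at hS
    rcases (by omega : 1 ≤ c ∨ c = 0) with hc1 | rfl
    · exact hmid c hc1 (by omega) ((hmix c hc1 (by omega)).2 hS)
    · have h1 : FacetAdj 3 (B 0) (A 1) := hadj (2 + N) 2 (by omega)
        (hB _ (by omega)) (hA _ (by omega) (by omega))
        (fun i hi => by rw [hmA, hmB]; omega) (fun i => by rw [hmA, hmB]; omega) (by omega)
      have h2 : FacetAdj 3 (B 0) (B 1) := hadj 0 2 (by omega)
        (hB _ (by omega)) (hB _ (by omega))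
        (fun i hi => by rw [hmB, hmB]; omega) (fun i => by rw [hmB, hmB]; omega) (by omega)
      have hNH : A 1 ∈ H := by
        by_contra hNH
        have hBH : B 1 ∉ H := fun h => hNH ((hmix 1 (by omega) (by omega)).2 h)
        have := hH.exit_unique _ hS _ _ (hA 1 (by omega) (by omega)) hNH h1
          (hB 1 (by omega)) hBH h2
        have h3 := (hmA 1 ⟨0, by omega⟩).2 (by simp)
        rw [this, hmB] at h3
        simp only at h3; omega
      exact hmid 1 le_rfl (by omega) hNH

/-- Some vertex of the cyclic polytope lies in a member of a Perles family, but in no facet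
outside the family. -/
theorem IsPerlesFamily.exists_common_hole {d n : ℕ} (hd : 1 ≤ d) (hn : d + 1 ≤ n)
    {H : Set (Finset (Fin n))} (hH : IsPerlesFamily d H)
    (hridge : ∀ S : Finset (Fin n), IsCyclicFacet d S → ∀ a ∈ S,
      ∃! T, IsCyclicFacet d T ∧ T ≠ S ∧ S.erase a ⊆ T) :
    ∃ i, (∃ S ∈ H, i ∈ S) ∧ ∀ T, IsCyclicFacet d T → T ∉ H → i ∉ T := by
  obtain ⟨N, rfl⟩ := Nat.exists_eq_add_of_le (show d ≤ n by omega)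
  rcases (by omega : N = 1 ∨ 2 ≤ N) with rfl | hN
  · exact hH.exists_common_hole_of_simplex
  rcases (by omega : d = 1 ∨ d = 2 ∨ d = 3 ∨ 4 ≤ d) with rfl | rfl | rfl | hd
  · exact hH.exists_common_hole_of_one
  · exact hH.exists_common_hole_of_two hridge
  · exact hH.exists_common_hole_of_three hN
  · exact hH.exists_common_hole_of_four_le hd hN

/-- A connected Perles family consists of all the facets that contain some fixed vertex. -/
theorem IsPerlesFamily.exists_eq_star {d n : ℕ} (hd : 1 ≤ d) (hn : d + 1 ≤ n)
    {H : Set (Finset (Fin n))} (hH : IsPerlesFamily d H)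
    (hridge : ∀ S : Finset (Fin n), IsCyclicFacet d S → ∀ a ∈ S,
      ∃! T, IsCyclicFacet d T ∧ T ≠ S ∧ S.erase a ⊆ T)
    (hconn : ∀ S ∈ H, ∀ T ∈ H,
      Relation.ReflTransGen (fun A B => B ∈ H ∧ FacetAdj d A B) S T) :
    ∃ i, (∃ S ∈ H, i ∈ S) ∧ ∀ S, S ∈ H ↔ IsCyclicFacet d S ∧ i ∈ S := by
  obtain ⟨i, ⟨S₀, hS₀, hi₀⟩, hi⟩ := hH.exists_common_hole hd hn hridge
  refine ⟨i, ⟨S₀, hS₀, hi₀⟩, fun S => ⟨fun hS => ⟨hH.isCyclicFacet S hS, ?_⟩, fun ⟨hS, hiS⟩ => ?_⟩⟩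
  · have key : ∀ T, Relation.ReflTransGen (fun A B => B ∈ H ∧ FacetAdj d A B) S₀ T →
        T ∈ H ∧ i ∈ T := by
      intro T hT
      induction hT with
      | refl => exact ⟨hS₀, hi₀⟩
      | @tail A B _ hAB ih =>
        obtain ⟨hB, hAB⟩ := hAB
        refine ⟨hB, ?_⟩
        by_contra hiB
        have hA := hH.isCyclicFacet A ih.1
        have herase : ∀ T, IsCyclicFacet d T → FacetAdj d A T → i ∉ T → A.erase i ⊆ T := by
          intro T hT hAT hiT
          obtain ⟨a, b, -, -, -, -, hex⟩ := hAT.exists_exchange hA.1 hT.1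
          have hia : i = a := by
            by_contra hia
            exact hiT ((hex i).2 ⟨.inl ih.2, hia⟩)
          intro j hj
          rw [Finset.mem_erase, hia] at hj
          exact (hex j).2 ⟨.inl hj.2, hj.1⟩
        -- The exit `Z` of `A` avoids `i`, as does `B`; both are then the unique neighbour across
        -- the ridge `A.erase i`, but `B` is in `H` and `Z` is not.
        obtain ⟨Z, hZ, hZH, hAZ⟩ := hH.exists_exit A ih.1
        have hBf := hH.isCyclicFacet B hB
        have := (hridge A hA i ih.2).unique
          ⟨hBf, hAB.1.symm, herase B hBf hAB hiB⟩ ⟨hZ, hAZ.1.symm, herase Z hZ hAZ (hi Z hZ hZH)⟩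
        exact hZH (this ▸ hB)
    exact (key S (hconn S₀ hS₀ S hS)).2
  · by_contra hSH
    exact hi S hS hSH hiS

end DimensionThree

/-! ### Simple systems of inequalities: vertices, edges and facets -/

section SimpleSystems

variable {E : Type*} [NormedAddCommGroup E] [InnerProductSpace ℝ E] {n d : ℕ}

/-- The polyhedron cut out by the inequalities `⟪a i, y⟫ ≤ 1`. -/
def polyhedron (a : Fin n → E) : Set E := {y | ∀ i, inner ℝ (a i) y ≤ 1}

/-- The face of the polyhedron on which the inequalities of `J` are equalities. -/
def polyhedronFace (a : Fin n → E) (J : Finset (Fin n)) : Set E :=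
  {y | y ∈ polyhedron a ∧ ∀ i ∈ J, inner ℝ (a i) y = 1}

open Classical in
/-- The inequalities that are equalities at `y`. -/
noncomputable def activeSet (a : Fin n → E) (y : E) : Finset (Fin n) :=
  Finset.univ.filter fun i => inner ℝ (a i) y = 1

/-- A system of inequalities that defines a simple polytope of dimension `d`. -/
structure IsSimpleSystem (d : ℕ) (a : Fin n → E) : Prop where
  finrank_eq : Module.finrank ℝ E = d
  isBounded : Bornology.IsBounded (polyhedron a)
  card_le : ∀ y ∈ polyhedron a, (activeSet a y).card ≤ d
  eq_zero : ∀ y ∈ polyhedron a, (activeSet a y).card = d →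
    ∀ w, (∀ i ∈ activeSet a y, inner ℝ (a i) w = 0) → w = 0

variable {a : Fin n → E}

lemma mem_activeSet {y : E} {i : Fin n} : i ∈ activeSet a y ↔ inner ℝ (a i) y = 1 := by
  simp [activeSet]

lemma polyhedronFace_empty : polyhedronFace a ∅ = polyhedron a := by
  ext y; simp [polyhedronFace]

lemma mem_polyhedronFace {J : Finset (Fin n)} {y : E} :
    y ∈ polyhedronFace a J ↔ y ∈ polyhedron a ∧ J ⊆ activeSet a y :=
  and_congr_right fun _ => forall₂_congr fun _ _ => mem_activeSet.symm

lemma convex_polyhedron : Convex ℝ (polyhedron a) := by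
  intro x hx y hy s t hs ht hst i
  rw [inner_add_right, inner_smul_right, inner_smul_right]
  nlinarith [hx i, hy i]

lemma convex_polyhedronFace {J : Finset (Fin n)} : Convex ℝ (polyhedronFace a J) := by
  intro x hx y hy s t hs ht hst
  refine ⟨convex_polyhedron hx.1 hy.1 hs ht hst, fun i hi => ?_⟩
  rw [inner_add_right, inner_smul_right, inner_smul_right, hx.2 i hi, hy.2 i hi]
  linarith

lemma isClosed_polyhedron : IsClosed (polyhedron a) := by
  simp only [polyhedron, Set.ofPred_forall]
  exact isClosed_iInter fun i => isClosed_le (by fun_prop) continuous_const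

/-- A short step in a feasible direction keeps inactive inequalities strict and keeps an active one
active exactly when it is orthogonal to the step. All local arguments on faces use this. -/
lemma eventually_add_smul_mem {y w : E} (hy : y ∈ polyhedron a)
    (hw : ∀ i ∈ activeSet a y, inner ℝ (a i) w ≤ 0) :
    ∀ᶠ δ in 𝓝[>] (0 : ℝ), y + δ • w ∈ polyhedron a ∧
      ∀ i, i ∈ activeSet a (y + δ • w) ↔ i ∈ activeSet a y ∧ inner ℝ (a i) w = 0 := by
  have key : ∀ i, ∀ᶠ δ in 𝓝[>] (0 : ℝ), inner ℝ (a i) (y + δ • w) ≤ 1 ∧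
      (i ∈ activeSet a (y + δ • w) ↔ i ∈ activeSet a y ∧ inner ℝ (a i) w = 0) := by
    intro i
    by_cases hi : i ∈ activeSet a y
    · have h1 := mem_activeSet.1 hi
      filter_upwards [self_mem_nhdsWithin] with δ hδ
      have hδ : 0 < δ := hδ
      rw [mem_activeSet, inner_add_right, inner_smul_right, h1]
      have h2 := hw i hi
      refine ⟨by nlinarith, ?_⟩
      simp [hi, hδ.ne']
    · have h1 : inner ℝ (a i) y < 1 := lt_of_le_of_ne (hy i) fun h => hi (mem_activeSet.2 h)
      have h2 : Tendsto (fun δ : ℝ => inner ℝ (a i) (y + δ • w)) (𝓝[>] 0)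
          (𝓝 (inner ℝ (a i) (y + (0 : ℝ) • w))) :=
        (Continuous.tendsto (by fun_prop) 0).mono_left nhdsWithin_le_nhds
      rw [zero_smul, add_zero] at h2
      filter_upwards [h2.eventually_lt_const h1] with δ hδ
      rw [mem_activeSet]
      exact ⟨hδ.le, fun h => absurd h hδ.ne, fun h => absurd h.1 hi⟩
  filter_upwards [eventually_all.2 key] with δ hδ
  exact ⟨fun i => (hδ i).1, fun i => (hδ i).2⟩

lemma mem_activeSet_convexComb {x y : E} (hx : x ∈ polyhedron a) (hy : y ∈ polyhedron a)
    {s t : ℝ} (hs : 0 < s) (ht : 0 < t) (hst : s + t = 1) {i : Fin n} :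
    i ∈ activeSet a (s • x + t • y) ↔ i ∈ activeSet a x ∧ i ∈ activeSet a y := by
  simp only [mem_activeSet, inner_add_right, inner_smul_right]
  have h1 := hx i
  have h2 := hy i
  constructor
  · intro h
    constructor <;> nlinarith
  · rintro ⟨h3, h4⟩
    rw [h3, h4]; linarith

/-- The sum of the functionals of `K` is at most `|K|`, with equality only where each of them equals
`1`. -/
lemma isExposed_polyhedronFace {J K : Finset (Fin n)} (hJK : J ⊆ K) :
    IsExposed ℝ (polyhedronFace a J) (polyhedronFace a K) := by
  rintro ⟨z, hz⟩
  refine ⟨∑ i ∈ K, innerSL ℝ (a i), ?_⟩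
  have hl : ∀ y, (∑ i ∈ K, innerSL ℝ (a i)) y = ∑ i ∈ K, inner ℝ (a i) y := fun y => by
    simp
  ext y
  simp only [Set.mem_ofPred_eq, hl]
  constructor
  · intro hy
    refine ⟨⟨hy.1, fun i hi => hy.2 i (hJK hi)⟩, fun x hx => ?_⟩
    exact Finset.sum_le_sum fun i hi => by rw [hy.2 i hi]; exact hx.1 i
  · rintro ⟨hy, hmax⟩
    refine ⟨hy.1, ?_⟩
    have h1 := hmax z ⟨hz.1, fun i hi => hz.2 i (hJK hi)⟩
    have h2 : ∑ i ∈ K, inner ℝ (a i) y = ∑ i ∈ K, inner ℝ (a i) z := by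
      refine le_antisymm (Finset.sum_le_sum fun i hi => ?_) h1
      rw [hz.2 i hi]; exact hy.1 i
    have h3 := (Finset.sum_eq_sum_iff_of_le fun i hi => by rw [hz.2 i hi]; exact hy.1 i).1 h2
    exact fun i hi => (h3 i hi).trans (hz.2 i hi)

lemma mem_vectorSpan_polyhedronFace {J : Finset (Fin n)} {y w : E} (hy : y ∈ polyhedronFace a J)
    (hw : ∀ i ∈ activeSet a y, inner ℝ (a i) w = 0) : w ∈ vectorSpan ℝ (polyhedronFace a J) := by
  have hJ := (mem_polyhedronFace.1 hy).2
  obtain ⟨δ, ⟨h1, h2⟩, hδ⟩ := ((eventually_add_smul_mem hy.1 fun i hi => (hw i hi).le).and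
    self_mem_nhdsWithin).exists
  have hδ : 0 < δ := hδ
  have hmem : y + δ • w ∈ polyhedronFace a J :=
    mem_polyhedronFace.2 ⟨h1, fun i hi => (h2 i).2 ⟨hJ hi, hw i (hJ hi)⟩⟩
  have := vsub_mem_vectorSpan ℝ hmem hy
  rw [vsub_eq_sub, add_sub_cancel_left] at this
  have h3 := Submodule.smul_mem _ δ⁻¹ this
  rwa [smul_smul, inv_mul_cancel₀ hδ.ne', one_smul] at h3

lemma exists_ne_zero_orthogonal [FiniteDimensional ℝ E] {ι : Type*} [Fintype ι] (v : ι → E)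
    (h : Fintype.card ι < Module.finrank ℝ E) : ∃ w ≠ 0, ∀ i, inner ℝ (v i) w = 0 := by
  let f : E →ₗ[ℝ] (ι → ℝ) := LinearMap.pi fun i => (innerSL ℝ (v i)).toLinearMap
  have hf : LinearMap.ker f ≠ ⊥ :=
    LinearMap.ker_ne_bot_of_finrank_lt (by rwa [Module.finrank_fintype_fun_eq_card])
  obtain ⟨w, hw, hw0⟩ := Submodule.exists_mem_ne_zero_of_ne_bot hf
  refine ⟨w, hw0, fun i => ?_⟩
  have := congrFun (LinearMap.mem_ker.1 hw) i
  simpa [f] using this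

namespace IsSimpleSystem

variable (hs : IsSimpleSystem d a)

include hs

lemma exists_direction [FiniteDimensional ℝ E] {y : E} (hy : y ∈ polyhedron a) (hc : (activeSet a y).card = d)
    (f : Fin n → ℝ) : ∃ w, ∀ i ∈ activeSet a y, inner ℝ (a i) w = f i := by
  let g : E →ₗ[ℝ] (activeSet a y → ℝ) := LinearMap.pi fun i => (innerSL ℝ (a i)).toLinearMap
  have hg : Function.Injective g := by
    rw [injective_iff_map_eq_zero]
    intro w hw
    refine hs.eq_zero y hy hc w fun i hi => ?_
    have := congrFun hw ⟨i, hi⟩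
    simpa [g] using this
  have hsurj := (LinearMap.injective_iff_surjective_of_finrank_eq_finrank (f := g) (by
    rw [Module.finrank_fintype_fun_eq_card, Fintype.card_coe, hc, hs.finrank_eq])).1 hg
  obtain ⟨w, hw⟩ := hsurj fun i => f i
  refine ⟨w, fun i hi => ?_⟩
  have := congrFun hw ⟨i, hi⟩
  simpa [g] using this

lemma eq_of_activeSet_subset {x y : E} (hx : x ∈ polyhedron a) (hc : (activeSet a x).card = d)
    (h : activeSet a x ⊆ activeSet a y) : x = y := by
  rw [← sub_eq_zero]
  refine hs.eq_zero x hx hc _ fun i hi => ?_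
  rw [inner_sub_right, mem_activeSet.1 hi, mem_activeSet.1 (h hi), sub_self]

/-- With fewer than `d` active inequalities some nonzero direction is orthogonal to all of them, and
steps both ways stay inside; with `d`, they determine the point. -/
lemma mem_extremePoints_iff [FiniteDimensional ℝ E] {y : E} :
    y ∈ (polyhedron a).extremePoints ℝ ↔ y ∈ polyhedron a ∧ (activeSet a y).card = d := by
  constructor
  · intro h
    refine ⟨h.1, le_antisymm (hs.card_le y h.1) ?_⟩
    by_contra! hlt
    obtain ⟨w, hw0, hw⟩ := exists_ne_zero_orthogonal (fun i : activeSet a y => a i)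
      (by rwa [Fintype.card_coe, hs.finrank_eq])
    obtain ⟨δ, ⟨⟨h1, -⟩, ⟨h2, -⟩⟩, hδ⟩ := (((eventually_add_smul_mem (w := w) h.1 fun i hi =>
      (hw ⟨i, hi⟩).le).and (eventually_add_smul_mem (w := -w) h.1 fun i hi => by
        rw [inner_neg_right, hw ⟨i, hi⟩, neg_zero])).and self_mem_nhdsWithin).exists
    have hδ : 0 < δ := hδ
    have h3 := h.2 h1 h2 ⟨1 / 2, 1 / 2, by norm_num, by norm_num, by norm_num, by module⟩
    rw [add_eq_left, smul_eq_zero] at h3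
    exact h3.elim hδ.ne' hw0
  · rintro ⟨hy, hc⟩
    refine ⟨hy, fun x₁ h₁ x₂ h₂ h => ?_⟩
    obtain ⟨s, t, hs0, ht0, hst, rfl⟩ := h
    exact (hs.eq_of_activeSet_subset hy hc fun i hi =>
      ((mem_activeSet_convexComb h₁ h₂ hs0 ht0 hst).1 hi).1).symm

lemma parallel {y : E} (hy : y ∈ polyhedron a) (hc : (activeSet a y).card = d) {j : Fin n}
    {w w' : E} (hw : ∀ i ∈ (activeSet a y).erase j, inner ℝ (a i) w = 0)
    (hw' : ∀ i ∈ (activeSet a y).erase j, inner ℝ (a i) w' = 0) (hj : inner ℝ (a j) w = -1) :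
    w' = (-inner ℝ (a j) w') • w := by
  rw [← sub_eq_zero]
  refine hs.eq_zero y hy hc _ fun i hi => ?_
  rw [inner_sub_right, inner_smul_right]
  by_cases hij : i = j
  · rw [hij, hj]; ring
  · rw [hw i (Finset.mem_erase.2 ⟨hij, hi⟩), hw' i (Finset.mem_erase.2 ⟨hij, hi⟩)]; ring

lemma card_inter_lt {x y : E} (hx : x ∈ polyhedron a) (hxc : (activeSet a x).card = d)
    (hne : x ≠ y) : (activeSet a x ∩ activeSet a y).card < d := by
  rw [← hxc]
  refine Finset.card_lt_card ⟨Finset.inter_subset_left, fun h => hne ?_⟩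
  exact hs.eq_of_activeSet_subset hx hxc (h.trans Finset.inter_subset_right)

/-- The vertices `x` and `y` span an edge as soon as they share `d - 1` equalities. -/
lemma segment_eq {x y : E} (hx : x ∈ polyhedron a) (hxc : (activeSet a x).card = d)
    (hy : y ∈ polyhedron a) (hyc : (activeSet a y).card = d)
    (h : (activeSet a x ∩ activeSet a y).card + 1 = d) :
    segment ℝ x y = polyhedronFace a (activeSet a x ∩ activeSet a y) := by
  -- One inequality is active at `x` but not at `y`; dropping it leaves a line, so the face lies on
  -- the ray from `x` through `y`. Exchanging the roles of the vertices cuts it down to the segment.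
  have key : ∀ x y : E, x ∈ polyhedron a → (activeSet a x).card = d → y ∈ polyhedron a →
      (activeSet a x ∩ activeSet a y).card + 1 = d →
      ∀ z ∈ polyhedronFace a (activeSet a x ∩ activeSet a y),
        ∃ t : ℝ, 0 ≤ t ∧ z = x + t • (y - x) := by
    intro x y hx hxc hy h z hz
    have h1 : ((activeSet a x) \ (activeSet a y)).card = 1 := by
      have := Finset.card_sdiff_add_card_inter (activeSet a x) (activeSet a y); omega
    obtain ⟨j, hj⟩ := Finset.card_eq_one.1 h1
    have hjm : ∀ i, i ∈ activeSet a x ∧ i ∉ activeSet a y ↔ i = j := fun i => by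
      rw [← Finset.mem_sdiff, hj, Finset.mem_singleton]
    have hjj := (hjm j).2 rfl
    have hj1 := mem_activeSet.1 hjj.1
    have hj2 : inner ℝ (a j) y < 1 := lt_of_le_of_ne (hy j) fun h => hjj.2 (mem_activeSet.2 h)
    have herase : ∀ i ∈ (activeSet a x).erase j, i ∈ activeSet a x ∩ activeSet a y := by
      intro i hi
      rw [Finset.mem_erase] at hi
      refine Finset.mem_inter.2 ⟨hi.2, ?_⟩
      by_contra hiy
      exact hi.1 ((hjm i).1 ⟨hi.2, hiy⟩)
    set c : ℝ := 1 - inner ℝ (a j) y with hcdef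
    have hc : 0 < c := by linarith
    have hpar := hs.parallel hx hxc (j := j) (w := c⁻¹ • (y - x)) (w' := z - x)
      (fun i hi => by
        have := Finset.mem_inter.1 (herase i hi)
        rw [inner_smul_right, inner_sub_right, mem_activeSet.1 this.1, mem_activeSet.1 this.2]
        ring)
      (fun i hi => by
        have := Finset.mem_inter.1 (herase i hi)
        rw [inner_sub_right, mem_activeSet.1 this.1, hz.2 i (herase i hi), sub_self])
      (by rw [inner_smul_right, inner_sub_right, hj1, show inner ℝ (a j) y - 1 = -c by
            rw [hcdef]; ring]
          field_simp)
    refine ⟨-inner ℝ (a j) (z - x) * c⁻¹, ?_, ?_⟩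
    · have := hz.1 j
      refine mul_nonneg ?_ (inv_nonneg.2 hc.le)
      rw [inner_sub_right, hj1]; linarith
    · rw [mul_smul, ← hpar]; abel
  apply Set.Subset.antisymm
  · exact convex_polyhedronFace.segment_subset
      (mem_polyhedronFace.2 ⟨hx, Finset.inter_subset_left⟩)
      (mem_polyhedronFace.2 ⟨hy, Finset.inter_subset_right⟩)
  · intro z hz
    obtain ⟨t, ht, hzt⟩ := key x y hx hxc hy h z hz
    obtain ⟨u, hu, hzu⟩ := key y x hy hyc hx (by rwa [Finset.inter_comm]) z
      (by rwa [Finset.inter_comm])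
    have hne : y - x ≠ 0 := by
      intro h0
      rw [sub_eq_zero] at h0
      rw [h0, Finset.inter_self] at h
      omega
    have h2 : (t + u - 1) • (y - x) = 0 := by
      have : x + t • (y - x) = y + u • (x - y) := hzt.symm.trans hzu
      have h3 : (t + u - 1) • (y - x) = (x + t • (y - x)) - (y + u • (x - y)) := by module
      rw [h3, this, sub_self]
    have h3 : t + u - 1 = 0 := (smul_eq_zero.1 h2).resolve_right hne
    exact ⟨1 - t, t, by linarith, ht, by ring, by rw [hzt]; module⟩

/-- The segment between two vertices of a face is exposed in it if and only if the vertices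
share `d - 1` equalities. -/
lemma isExposed_segment_iff [FiniteDimensional ℝ E] {x y : E} (hx : x ∈ polyhedron a)
    (hxc : (activeSet a x).card = d) (hy : y ∈ polyhedron a) (hyc : (activeSet a y).card = d)
    (hne : x ≠ y) {J : Finset (Fin n)} (hJ : J ⊆ activeSet a x ∩ activeSet a y) :
    IsExposed ℝ (polyhedronFace a J) (segment ℝ x y) ↔
      (activeSet a x ∩ activeSet a y).card + 1 = d := by
  constructor
  · intro hexp
    by_contra hcard
    have hlt := hs.card_inter_lt hx hxc hne
    set T := activeSet a x ∩ activeSet a y with hT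
    obtain ⟨l, hl⟩ := hexp ⟨x, left_mem_segment ℝ x y⟩
    -- With fewer than `d - 1` common equalities, one more condition, orthogonality to the segment,
    -- still leaves a nonzero `w`. Steps along `±w` from the midpoint stay in the face, so an
    -- exposing functional vanishes on `w` and the exposed set leaves the segment.
    obtain ⟨w, hw0, hw⟩ := exists_ne_zero_orthogonal
      (fun o : Option T => o.elim (y - x) fun i => a i)
      (by rw [Fintype.card_option, Fintype.card_coe, hs.finrank_eq]; omega)
    have hwu : inner ℝ (y - x) w = 0 := hw none
    have hwT : ∀ i ∈ T, inner ℝ (a i) w = 0 := fun i hi => hw (some ⟨i, hi⟩)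
    set m : E := (1 / 2 : ℝ) • x + (1 / 2 : ℝ) • y with hm
    have hmem : m ∈ segment ℝ x y := ⟨1 / 2, 1 / 2, by norm_num, by norm_num, by norm_num, rfl⟩
    have hmP : m ∈ polyhedron a :=
      convex_polyhedron hx hy (by norm_num) (by norm_num) (by norm_num)
    have hmT : ∀ i, i ∈ activeSet a m ↔ i ∈ T := fun i => by
      rw [hm, mem_activeSet_convexComb hx hy (by norm_num) (by norm_num) (by norm_num), hT,
        Finset.mem_inter]
    have hpert : ∀ w, (∀ i ∈ T, inner ℝ (a i) w = 0) →
        ∃ δ : ℝ, 0 < δ ∧ m + δ • w ∈ polyhedronFace a J := by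
      intro w hw
      obtain ⟨δ, ⟨h1, h2⟩, hδ⟩ := ((eventually_add_smul_mem (w := w) hmP fun i hi =>
        (hw i ((hmT i).1 hi)).le).and self_mem_nhdsWithin).exists
      exact ⟨δ, hδ, mem_polyhedronFace.2 ⟨h1, fun i hi =>
        (h2 i).2 ⟨(hmT i).2 (hJ hi), hw i (hJ hi)⟩⟩⟩
    obtain ⟨δ, hδ, h1⟩ := hpert w hwT
    obtain ⟨δ', hδ', h2⟩ := hpert (-w) fun i hi => by rw [inner_neg_right, hwT i hi, neg_zero]
    have hmax := (hl ▸ hmem : m ∈ {x ∈ polyhedronFace a J | ∀ y ∈ polyhedronFace a J, l y ≤ l x}).2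
    have h3 := hmax _ h1
    have h4 := hmax _ h2
    rw [map_add, map_smul, smul_eq_mul] at h3 h4
    rw [map_neg] at h4
    have hlw : l w = 0 := by
      by_contra hne
      rcases lt_or_gt_of_ne hne with h | h
      · nlinarith
      · nlinarith
    have h5 : m + δ • w ∈ segment ℝ x y := by
      rw [hl]
      refine ⟨h1, fun z hz => ?_⟩
      rw [map_add, map_smul, hlw, smul_zero, add_zero]
      exact hmax z hz
    obtain ⟨s, t, -, -, hst, h6⟩ := h5
    have h7 : δ • w = (t - 1 / 2) • (y - x) := by
      have : δ • w = (s • x + t • y) - m := by rw [h6]; abel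
      rw [this, hm, show s = 1 - t by linarith]
      module
    have h8 : inner ℝ (δ • w) w = 0 := by
      rw [h7, inner_smul_left, hwu]; simp
    rw [inner_smul_left, mul_eq_zero] at h8
    rcases h8 with h8 | h8
    · simp at h8; exact hδ.ne' h8
    · exact hw0 (inner_self_eq_zero.1 h8)
  · intro h
    rw [hs.segment_eq hx hxc hy hyc h]
    exact isExposed_polyhedronFace hJ

/-- Each ridge at a vertex leads to exactly one other vertex. -/
lemma existsUnique_neighbour [FiniteDimensional ℝ E] {y : E} (hy : y ∈ polyhedron a)
    (hc : (activeSet a y).card = d) {j : Fin n} (hj : j ∈ activeSet a y) :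
    ∃! z, z ∈ polyhedron a ∧ (activeSet a z).card = d ∧ z ≠ y ∧
      (activeSet a y).erase j ⊆ activeSet a z := by
  obtain ⟨w, hw⟩ := hs.exists_direction hy hc fun i => if i = j then -1 else 0
  have hwj : inner ℝ (a j) w = -1 := by rw [hw j hj, if_pos rfl]
  have hw0 : ∀ i ∈ (activeSet a y).erase j, inner ℝ (a i) w = 0 := fun i hi => by
    rw [Finset.mem_erase] at hi
    rw [hw i hi.2, if_neg hi.1]
  have hwne : w ≠ 0 := by
    rintro rfl; rw [inner_zero_right] at hwj; norm_num at hwj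
  have hcard : ((activeSet a y).erase j).card + 1 = d := by
    rw [Finset.card_erase_add_one hj, hc]
  have hadj : ∀ z, z ∈ polyhedron a → (activeSet a z).card = d → z ≠ y →
      (activeSet a y).erase j ⊆ activeSet a z →
      activeSet a y ∩ activeSet a z = (activeSet a y).erase j := by
    intro z hz hzc hzy hsub
    symm
    refine Finset.eq_of_subset_of_card_le
      (Finset.subset_inter (Finset.erase_subset _ _) hsub) ?_
    have := hs.card_inter_lt hy hc hzy.symm
    omega
  -- Follow the edge direction as far as possible; the maximum exists by boundedness, and there a
  -- new inequality becomes active, as otherwise one could go further.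
  set D : Set ℝ := {δ | 0 ≤ δ ∧ y + δ • w ∈ polyhedron a} with hD
  have hDne : D.Nonempty := ⟨0, le_rfl, by simpa using hy⟩
  have hDclosed : IsClosed D := by
    have : D = Set.Ici 0 ∩ (fun δ : ℝ => y + δ • w) ⁻¹' polyhedron a := rfl
    rw [this]
    exact isClosed_Ici.inter (isClosed_polyhedron.preimage (by fun_prop))
  have hDbdd : BddAbove D := by
    obtain ⟨C, hC⟩ := hs.isBounded.exists_norm_le
    refine ⟨(C + ‖y‖) / ‖w‖, fun δ hδ => ?_⟩
    rw [le_div_iff₀ (norm_pos_iff.2 hwne)]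
    have h1 := hC _ hδ.2
    have h2 : ‖δ • w‖ = δ * ‖w‖ := by rw [norm_smul, Real.norm_of_nonneg hδ.1]
    have h3 := norm_sub_le (y + δ • w) y
    rw [add_sub_cancel_left, h2] at h3
    linarith
  have hmem : sSup D ∈ D := hDclosed.csSup_mem hDne hDbdd
  set δ := sSup D with hδdef
  have hδ : 0 < δ := by
    obtain ⟨e, ⟨h1, -⟩, he⟩ := ((eventually_add_smul_mem (w := w) hy fun i hi => by
      by_cases hij : i = j
      · rw [hij, hwj]; norm_num
      · rw [hw0 i (Finset.mem_erase.2 ⟨hij, hi⟩)]).and self_mem_nhdsWithin).exists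
    have he : 0 < e := he
    exact he.trans_le (le_csSup hDbdd ⟨he.le, h1⟩)
  set z := y + δ • w with hz
  have hzP : z ∈ polyhedron a := hmem.2
  have hsub : (activeSet a y).erase j ⊆ activeSet a z := fun i hi => by
    rw [mem_activeSet, hz, inner_add_right, inner_smul_right, hw0 i hi,
      mem_activeSet.1 (Finset.mem_of_mem_erase hi)]
    ring
  have hzc : (activeSet a z).card = d := by
    refine le_antisymm (hs.card_le z hzP) ?_
    by_contra! hlt
    have heq : (activeSet a y).erase j = activeSet a z :=
      Finset.eq_of_subset_of_card_le hsub (by omega)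
    obtain ⟨e, ⟨h1, -⟩, he⟩ := ((eventually_add_smul_mem (w := w) hzP fun i hi =>
      (hw0 i (heq ▸ hi)).le).and self_mem_nhdsWithin).exists
    have he : 0 < e := he
    have h2 : δ + e ∈ D := ⟨by linarith, by rw [add_smul, ← add_assoc]; exact h1⟩
    have := le_csSup hDbdd h2
    linarith
  have hzy : z ≠ y := fun h => by
    rw [hz, add_eq_left, smul_eq_zero] at h
    exact h.elim hδ.ne' hwne
  refine ⟨z, ⟨hzP, hzc, hzy, hsub⟩, fun x ⟨hxP, hxc, hxy, hxsub⟩ => ?_⟩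
  have h1 := hadj z hzP hzc hzy hsub
  have h2 := hadj x hxP hxc hxy hxsub
  have hxz : x ∈ segment ℝ y z := by
    rw [hs.segment_eq hy hc hzP hzc (by rw [h1, hcard]), h1]
    exact mem_polyhedronFace.2 ⟨hxP, hxsub⟩
  rw [← insert_endpoints_openSegment] at hxz
  rcases hxz with h | h | h
  · exact absurd h hxy
  · exact h
  · obtain ⟨s, t, hs0, ht0, hst, rfl⟩ := h
    have : activeSet a (s • y + t • z) ⊆ (activeSet a y).erase j := fun i hi => by
      rw [← h1, Finset.mem_inter]
      exact (mem_activeSet_convexComb hy hzP hs0 ht0 hst).1 hi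
    have := Finset.card_le_card this
    omega

lemma isCompact [FiniteDimensional ℝ E] : IsCompact (polyhedron a) :=
  Metric.isCompact_of_isClosed_isBounded isClosed_polyhedron hs.isBounded

lemma finite_extremePoints [FiniteDimensional ℝ E] :
    ((polyhedron a).extremePoints ℝ).Finite := by
  refine Set.Finite.of_finite_image (f := activeSet a) (Set.toFinite _) fun x hx y hy hxy => ?_
  rw [hs.mem_extremePoints_iff] at hx hy
  exact hs.eq_of_activeSet_subset hx.1 hx.2 hxy.subset

lemma convexHull_extremePoints [FiniteDimensional ℝ E] :
    convexHull ℝ ((polyhedron a).extremePoints ℝ) = polyhedron a := by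
  rw [← (hs.finite_extremePoints.isClosed_convexHull ℝ).closure_eq,
    closure_convexHull_extremePoints hs.isCompact convex_polyhedron]

lemma finrank_vectorSpan : Module.finrank ℝ (vectorSpan ℝ (polyhedron a)) = d := by
  have h0 : (0 : E) ∈ polyhedron a := fun i => by rw [inner_zero_right]; exact zero_le_one
  have : vectorSpan ℝ (polyhedron a) = ⊤ := by
    rw [eq_top_iff]
    intro w _
    rw [← polyhedronFace_empty]
    refine mem_vectorSpan_polyhedronFace (y := 0) (by rwa [polyhedronFace_empty]) fun i hi => ?_
    rw [mem_activeSet, inner_zero_right] at hi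
    norm_num at hi
  rw [this, finrank_top, hs.finrank_eq]

/-- Stepping from the vertex off all active inequalities except `j` reaches a point where only `j`
is active; around it the face fills the hyperplane orthogonal to `a j`. -/
lemma finrank_vectorSpan_polyhedronFace [FiniteDimensional ℝ E] {y : E} (hy : y ∈ polyhedron a)
    (hc : (activeSet a y).card = d) {j : Fin n} (hj : j ∈ activeSet a y) :
    Module.finrank ℝ (vectorSpan ℝ (polyhedronFace a {j})) + 1 = d := by
  obtain ⟨w, hw⟩ := hs.exists_direction hy hc fun i => if i = j then 0 else -1
  obtain ⟨δ, hδ, hact⟩ := (eventually_add_smul_mem (w := w) hy fun i hi => by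
    rw [hw i hi]; split_ifs <;> norm_num).exists
  have hact' : ∀ i, i ∈ activeSet a (y + δ • w) ↔ i = j := fun i => by
    rw [hact]
    constructor
    · rintro ⟨hi, h0⟩
      by_contra hij
      rw [hw i hi, if_neg hij] at h0
      norm_num at h0
    · rintro rfl
      exact ⟨hj, by rw [hw i hj, if_pos rfl]⟩
  have haj : a j ≠ 0 := fun h0 => by
    have := mem_activeSet.1 hj
    rw [h0, inner_zero_left] at this
    norm_num at this
  have hspan : vectorSpan ℝ (polyhedronFace a {j}) = (ℝ ∙ a j)ᗮ := by
    apply le_antisymm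
    · rw [vectorSpan, Submodule.span_le]
      rintro _ ⟨x, hx, x', hx', rfl⟩
      rw [SetLike.mem_coe, Submodule.mem_orthogonal_singleton_iff_inner_right]
      change inner ℝ (a j) (x - x') = 0
      rw [inner_sub_right, hx.2 j (by simp), hx'.2 j (by simp), sub_self]
    · intro v hv
      rw [Submodule.mem_orthogonal_singleton_iff_inner_right] at hv
      refine mem_vectorSpan_polyhedronFace (y := y + δ • w)
        (mem_polyhedronFace.2 ⟨hδ, fun i hi => (hact' i).2 (Finset.mem_singleton.1 hi)⟩)
        fun i hi => ?_
      rw [(hact' i).1 hi, hv]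
  have h1 := Submodule.finrank_add_finrank_orthogonal (ℝ ∙ a j)
  rw [finrank_span_singleton haj, hs.finrank_eq] at h1
  rw [hspan]; omega

/-- The criterion does not depend on `J`: with `J = ∅` it describes the graph of the polytope, with
`J = {j}` that of a facet, which is therefore an induced subgraph. -/
lemma isPolytopeEdge_iff [FiniteDimensional ℝ E] {J : Finset (Fin n)} {x y : E}
    (hx : x ∈ polyhedron a) (hxc : (activeSet a x).card = d) (hxJ : J ⊆ activeSet a x)
    (hy : y ∈ polyhedron a) (hyc : (activeSet a y).card = d) (hyJ : J ⊆ activeSet a y) :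
    IsPolytopeEdge (polyhedronFace a J) x y ↔ FacetAdj d (activeSet a x) (activeSet a y) := by
  have hext : ∀ z ∈ polyhedron a, (activeSet a z).card = d → J ⊆ activeSet a z →
      z ∈ (polyhedronFace a J).extremePoints ℝ := by
    intro z hz hzc hzJ
    have := (isExposed_polyhedronFace (a := a) (Finset.empty_subset J)).isExtreme.extremePoints_eq
    rw [this, polyhedronFace_empty]
    exact ⟨mem_polyhedronFace.2 ⟨hz, hzJ⟩, hs.mem_extremePoints_iff.2 ⟨hz, hzc⟩⟩
  constructor
  · rintro ⟨-, -, hne, hexp⟩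
    exact ⟨fun h => hne (hs.eq_of_activeSet_subset hx hxc h.subset),
      (hs.isExposed_segment_iff hx hxc hy hyc hne (Finset.subset_inter hxJ hyJ)).1 hexp⟩
  · rintro ⟨hne, hcard⟩
    have hne' : x ≠ y := fun h => hne (h ▸ rfl)
    exact ⟨hext x hx hxc hxJ, hext y hy hyc hyJ, hne',
      (hs.isExposed_segment_iff hx hxc hy hyc hne' (Finset.subset_inter hxJ hyJ)).2 hcard⟩

lemma extremePoints_polyhedronFace [FiniteDimensional ℝ E] {J : Finset (Fin n)} {y : E} :
    y ∈ (polyhedronFace a J).extremePoints ℝ ↔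
      y ∈ polyhedron a ∧ (activeSet a y).card = d ∧ J ⊆ activeSet a y := by
  have := (isExposed_polyhedronFace (a := a) (Finset.empty_subset J)).isExtreme.extremePoints_eq
  rw [this, polyhedronFace_empty, Set.mem_inter_iff, mem_polyhedronFace, hs.mem_extremePoints_iff]
  tauto

lemma adj_iff [FiniteDimensional ℝ E] (v w : (polyhedron a).extremePoints ℝ) :
    (polytopeGraph (polyhedron a)).Adj v w ↔ FacetAdj d (activeSet a v) (activeSet a w) := by
  have hv := hs.mem_extremePoints_iff.1 v.2
  have hw := hs.mem_extremePoints_iff.1 w.2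
  have := hs.isPolytopeEdge_iff hv.1 hv.2 (Finset.empty_subset _) hw.1 hw.2 (Finset.empty_subset _)
  rw [polyhedronFace_empty] at this
  exact this

/-- Neighbours of a vertex correspond to the active inequality that is given up. -/
lemma encard_neighborSet [FiniteDimensional ℝ E] (v : (polyhedron a).extremePoints ℝ) :
    ((polytopeGraph (polyhedron a)).neighborSet v).encard = d := by
  have hv := hs.mem_extremePoints_iff.1 v.2
  have hex : ∀ j : activeSet a (v : E), ∃ w : (polyhedron a).extremePoints ℝ, w ≠ v ∧
      (activeSet a (v : E)).erase j ⊆ activeSet a (w : E) := fun j => by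
    obtain ⟨z, ⟨h1, h2, h3, h4⟩, -⟩ := hs.existsUnique_neighbour hv.1 hv.2 j.2
    exact ⟨⟨z, hs.mem_extremePoints_iff.2 ⟨h1, h2⟩⟩, fun h => h3 (congrArg Subtype.val h), h4⟩
  choose f hf1 hf2 using hex
  have hfact : ∀ j, activeSet a (v : E) ≠ activeSet a (f j : E) := fun j h =>
    hf1 j (Subtype.ext (hs.eq_of_activeSet_subset hv.1 hv.2 h.subset).symm)
  have hinj : Function.Injective f := by
    intro j k hjk
    by_contra hne
    refine hfact j (Finset.eq_of_subset_of_card_le (fun i hi => ?_) ?_)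
    · by_cases hij : i = j
      · rw [hjk]
        exact hf2 k (Finset.mem_erase.2 ⟨fun h => hne (Subtype.ext (hij.symm.trans h)), hi⟩)
      · exact hf2 j (Finset.mem_erase.2 ⟨hij, hi⟩)
    · rw [hv.2, (hs.mem_extremePoints_iff.1 (f j).2).2]
  have hrange : (polytopeGraph (polyhedron a)).neighborSet v = Set.range f := by
    ext w
    have hw := hs.mem_extremePoints_iff.1 w.2
    rw [SimpleGraph.mem_neighborSet, hs.adj_iff, Set.mem_range]
    constructor
    · intro h
      obtain ⟨j, b, hj, hjw, -, -, hex⟩ := h.exists_exchange hv.2 hw.2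
      refine ⟨⟨j, hj⟩, Subtype.ext ?_⟩
      have hfj := hs.mem_extremePoints_iff.1 (f ⟨j, hj⟩).2
      refine (hs.existsUnique_neighbour hv.1 hv.2 hj).unique
        ⟨hfj.1, hfj.2, fun h => hf1 _ (Subtype.ext h), hf2 ⟨j, hj⟩⟩
        ⟨hw.1, hw.2, fun h' => h.1 (by rw [h']), fun i hi => ?_⟩
      rw [Finset.mem_erase] at hi
      exact (hex i).2 ⟨.inl hi.2, hi.1⟩
    · rintro ⟨j, rfl⟩
      exact facetAdj_of_erase_subset hv.2 (hs.mem_extremePoints_iff.1 (f j).2).2 (hfact j) (hf2 j)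
  rw [hrange, ← Set.image_univ, hinj.encard_image, Set.encard_univ, ENat.card_eq_coe_fintype_card,
    Fintype.card_coe, hv.2]

theorem isSimplePolytope [FiniteDimensional ℝ E] : IsSimplePolytope d (polyhedron a) where
  exists_finite := by
    refine ⟨(polyhedron a).extremePoints ℝ, hs.finite_extremePoints,
      hs.isCompact.extremePoints_nonempty ⟨0, fun i => ?_⟩, hs.convexHull_extremePoints.symm⟩
    rw [inner_zero_right]; exact zero_le_one
  dim_eq := hs.finrank_vectorSpan
  degree_eq := hs.encard_neighborSet

lemma isPolytopeFacet [FiniteDimensional ℝ E] {y : E} (hy : y ∈ polyhedron a)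
    (hc : (activeSet a y).card = d) {j : Fin n} (hj : j ∈ activeSet a y) :
    IsPolytopeFacet (polyhedron a) (polyhedronFace a {j}) := by
  refine ⟨?_, ⟨y, mem_polyhedronFace.2 ⟨hy, by simpa using hj⟩⟩, ?_⟩
  · have := isExposed_polyhedronFace (a := a) (Finset.empty_subset {j})
    rwa [polyhedronFace_empty] at this
  · rw [hs.finrank_vectorSpan_polyhedronFace hy hc hj, hs.finrank_vectorSpan]

end IsSimpleSystem

end SimpleSystems

/-! ### From subgraphs of the polytope graph to Perles families -/

section PerlesForSimpleSystems

variable {E : Type*} [NormedAddCommGroup E] [InnerProductSpace ℝ E] [FiniteDimensional ℝ E]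
  {n d : ℕ} {a : Fin n → E}

/-- Perles' conjecture holds for a simple system whose vertices correspond to the facets of the
cyclic polytope. -/
theorem IsSimpleSystem.satisfiesPerlesConjecture (hs : IsSimpleSystem d a) (hd : 1 ≤ d)
    (hn : d + 1 ≤ n)
    (hfac : ∀ S : Finset (Fin n), IsCyclicFacet d S ↔
      ∃ y ∈ polyhedron a, (activeSet a y).card = d ∧ activeSet a y = S) :
    SatisfiesPerlesConjecture d (polyhedron a) := by
  refine ⟨hs.isSimplePolytope, fun H hind hconn hreg hsep => ?_⟩
  set φ : (polyhedron a).extremePoints ℝ → Finset (Fin n) := fun v => activeSet a (v : E) with hφ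
  have hv : ∀ v : (polyhedron a).extremePoints ℝ,
      (v : E) ∈ polyhedron a ∧ (φ v).card = d := fun v => hs.mem_extremePoints_iff.1 v.2
  have hφf : ∀ v, IsCyclicFacet d (φ v) := fun v => (hfac _).2 ⟨v, (hv v).1, (hv v).2, rfl⟩
  have hφs : ∀ S, IsCyclicFacet d S → ∃ v, φ v = S := fun S hS => by
    obtain ⟨y, hy, hyc, rfl⟩ := (hfac S).1 hS
    exact ⟨⟨y, hs.mem_extremePoints_iff.2 ⟨hy, hyc⟩⟩, rfl⟩
  have hφi : Function.Injective φ := fun v w h =>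
    Subtype.ext (hs.eq_of_activeSet_subset (hv v).1 (hv v).2 (Eq.subset h))
  have hadj : ∀ v w, (polytopeGraph (polyhedron a)).Adj v w ↔ FacetAdj d (φ v) (φ w) := hs.adj_iff
  set 𝓗 : Set (Finset (Fin n)) := φ '' H.verts with h𝓗
  have hmem : ∀ v, φ v ∈ 𝓗 ↔ v ∈ H.verts := fun v => hφi.mem_set_image
  -- As `H` is induced, its neighbours of `v` are all the neighbours within its vertex set; degree
  -- `d` against `d - 1` leaves exactly one outside.
  have hexit : ∀ v ∈ H.verts, ∃ u, ∀ w,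
      (polytopeGraph (polyhedron a)).Adj v w ∧ w ∉ H.verts ↔ w = u := by
    intro v hvH
    have h1 : H.neighborSet v = (polytopeGraph (polyhedron a)).neighborSet v ∩ H.verts := by
      ext w
      exact ⟨fun h => ⟨H.adj_sub h, H.edge_vert h.symm⟩, fun h => hind hvH h.2 h.1⟩
    have h2 := hreg v hvH
    have h3 := Set.encard_sdiff_add_encard_inter ((polytopeGraph (polyhedron a)).neighborSet v) H.verts
    rw [← h1, hs.encard_neighborSet v, ← h2, add_comm] at h3
    have h4 : (H.neighborSet v).encard ≠ ⊤ := by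
      intro h
      rw [h, top_add] at h2
      exact ENat.natCast_ne_top d h2.symm
    have h5 := ENat.add_right_injective_of_ne_top h4 h3
    obtain ⟨u, hu⟩ := Set.encard_eq_one.1 h5
    refine ⟨u, fun w => ?_⟩
    have : w ∈ (polytopeGraph (polyhedron a)).neighborSet v \ H.verts ↔ w = u := by rw [hu, Set.mem_singleton_iff]
    exact this
  have hridge : ∀ S : Finset (Fin n), IsCyclicFacet d S → ∀ j ∈ S,
      ∃! T, IsCyclicFacet d T ∧ T ≠ S ∧ S.erase j ⊆ T := by
    intro S hS j hj
    obtain ⟨v, rfl⟩ := hφs S hS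
    obtain ⟨z, ⟨hz, hzc, hzv, hsub⟩, huniq⟩ := hs.existsUnique_neighbour (hv v).1 (hv v).2 hj
    refine ⟨activeSet a z, ⟨(hfac _).2 ⟨z, hz, hzc, rfl⟩, fun h => hzv ?_, hsub⟩, ?_⟩
    · exact hs.eq_of_activeSet_subset hz hzc (Eq.subset h)
    · rintro T ⟨hT, hTv, hTsub⟩
      obtain ⟨w, rfl⟩ := hφs T hT
      have := huniq w ⟨(hv w).1, (hv w).2, fun h => hTv (congrArg (activeSet a) h), hTsub⟩
      exact congrArg (activeSet a) this
  have hP : IsPerlesFamily d 𝓗 := by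
    refine ⟨?_, ?_, ?_, ?_, ?_⟩
    · rintro _ ⟨v, -, rfl⟩
      exact hφf v
    · obtain ⟨v⟩ := hconn.coe.nonempty
      exact ⟨_, v, v.2, rfl⟩
    · rintro _ ⟨v, hvH, rfl⟩
      obtain ⟨u, hu⟩ := hexit v hvH
      obtain ⟨h1, h2⟩ := (hu u).2 rfl
      exact ⟨φ u, hφf u, (hmem u).not.2 h2, (hadj v u).1 h1⟩
    · rintro _ ⟨v, hvH, rfl⟩ T T' hT hTH hvT hT' hTH' hvT'
      obtain ⟨u, hu⟩ := hexit v hvH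
      obtain ⟨w, rfl⟩ := hφs T hT
      obtain ⟨w', rfl⟩ := hφs T' hT'
      rw [(hu w).1 ⟨(hadj v w).2 hvT, (hmem w).not.1 hTH⟩,
        (hu w').1 ⟨(hadj v w').2 hvT', (hmem w').not.1 hTH'⟩]
    · intro S T hS hSH hT hTH
      obtain ⟨v, rfl⟩ := hφs S hS
      obtain ⟨w, rfl⟩ := hφs T hT
      have h1 := hsep ⟨v, (hmem v).not.1 hSH⟩ ⟨w, (hmem w).not.1 hTH⟩
      rw [SimpleGraph.reachable_iff_reflTransGen] at h1
      refine h1.lift (fun u : (H.vertsᶜ : Set _) => φ u.1) fun x y hxy => ⟨hφf y, (hmem y).not.2 y.2, ?_⟩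
      exact (hadj x y).1 (SimpleGraph.comap_adj.1 hxy)
  obtain ⟨i, ⟨S₀, hS₀, hi₀⟩, hi⟩ := hP.exists_eq_star hd hn hridge (by
    rintro _ ⟨v, hvH, rfl⟩ _ ⟨w, hwH, rfl⟩
    have h1 := hconn.coe.preconnected ⟨v, hvH⟩ ⟨w, hwH⟩
    rw [SimpleGraph.reachable_iff_reflTransGen] at h1
    refine h1.lift (fun u : H.verts => φ u.1) fun x y hxy => ⟨(hmem y).2 y.2, ?_⟩
    exact (hadj x y).1 (H.adj_sub hxy))
  have hstar : ∀ v, v ∈ H.verts ↔ i ∈ activeSet a (v : E) := fun v => by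
    rw [← hmem, hi]
    exact and_iff_right (hφf v)
  have hext : ∀ y, y ∈ (polyhedronFace a {i}).extremePoints ℝ ↔
      ∃ v : (polyhedron a).extremePoints ℝ, v ∈ H.verts ∧ (v : E) = y := fun y => by
    rw [hs.extremePoints_polyhedronFace]
    constructor
    · rintro ⟨h1, h2, h3⟩
      exact ⟨⟨y, hs.mem_extremePoints_iff.2 ⟨h1, h2⟩⟩,
        (hstar _).2 (Finset.singleton_subset_iff.1 h3), rfl⟩
    · rintro ⟨v, hvH, rfl⟩
      exact ⟨(hv v).1, (hv v).2, Finset.singleton_subset_iff.2 ((hstar v).1 hvH)⟩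
  obtain ⟨v₀, -, rfl⟩ := hS₀
  refine ⟨polyhedronFace a {i}, hs.isPolytopeFacet (hv v₀).1 (hv v₀).2 hi₀, ?_, fun v w => ?_⟩
  · ext y
    rw [hext]; rfl
  · have hedge : v ∈ H.verts → w ∈ H.verts →
        (IsPolytopeEdge (polyhedronFace a {i}) (v : E) (w : E) ↔ FacetAdj d (φ v) (φ w)) :=
      fun h1 h2 => hs.isPolytopeEdge_iff (hv v).1 (hv v).2
        (Finset.singleton_subset_iff.2 ((hstar v).1 h1)) (hv w).1 (hv w).2
        (Finset.singleton_subset_iff.2 ((hstar w).1 h2))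
    constructor
    · intro h
      exact (hedge (H.edge_vert h) (H.edge_vert h.symm)).2 ((hadj v w).1 (H.adj_sub h))
    · intro h
      obtain ⟨v', hv', hvv⟩ := (hext _).1 h.1
      obtain ⟨w', hw', hww⟩ := (hext _).1 h.2.1
      rw [Subtype.ext hvv] at hv'
      rw [Subtype.ext hww] at hw'
      exact hind hv' hw' ((hadj v w).2 ((hedge hv' hw').1 h))

end PerlesForSimpleSystems

/-! ### The moment curve: general position and Gale's criterion -/

section MomentCurve

variable {d n : ℕ}

open Polynomial in
/-- The polynomial with coefficients `y` in positive degrees and constant coefficient `b`. -/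
noncomputable def curvePolynomial (y : EuclideanSpace ℝ (Fin d)) (b : ℝ) : ℝ[X] :=
  ∑ j : Fin d, C (y j) * X ^ ((j : ℕ) + 1) + C b

lemma eval_curvePolynomial (y : EuclideanSpace ℝ (Fin d)) (b s : ℝ) :
    (curvePolynomial y b).eval s = inner ℝ (momentCurve d s) y + b := by
  simp only [curvePolynomial, Polynomial.eval_add, Polynomial.eval_finsetSum,
    Polynomial.eval_mul, Polynomial.eval_C, Polynomial.eval_pow, Polynomial.eval_X,
    PiLp.inner_apply, momentCurve]
  simp

lemma natDegree_curvePolynomial (y : EuclideanSpace ℝ (Fin d)) (b : ℝ) :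
    (curvePolynomial y b).natDegree ≤ d := by
  refine Polynomial.natDegree_add_le_of_degree_le ?_ (by simp)
  refine Polynomial.natDegree_sum_le_of_forall_le _ _ fun j _ => ?_
  exact (Polynomial.natDegree_C_mul_X_pow_le _ _).trans j.2

lemma coeff_curvePolynomial (y : EuclideanSpace ℝ (Fin d)) (b : ℝ) (j : Fin d) :
    (curvePolynomial y b).coeff (j + 1) = y j := by
  simp only [curvePolynomial, Polynomial.coeff_add, Polynomial.finsetSum_coeff,
    Polynomial.coeff_C_mul_X_pow, Polynomial.coeff_C_succ, add_zero]
  rw [Finset.sum_eq_single j]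
  · simp
  · intro k _ hk
    rw [if_neg]
    intro h
    exact hk (Fin.ext (by omega))
  · simp

lemma coeff_zero_curvePolynomial (y : EuclideanSpace ℝ (Fin d)) (b : ℝ) :
    (curvePolynomial y b).coeff 0 = b := by
  simp [curvePolynomial]

lemma exists_curvePolynomial_eq {p : Polynomial ℝ} (hp : p.natDegree ≤ d) :
    ∃ (y : EuclideanSpace ℝ (Fin d)) (b : ℝ), curvePolynomial y b = p := by
  refine ⟨WithLp.toLp 2 fun j => p.coeff (j + 1), p.coeff 0, ?_⟩
  ext k
  rcases Nat.eq_zero_or_pos k with rfl | hk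
  · exact coeff_zero_curvePolynomial _ _
  · by_cases hkd : k ≤ d
    · have := coeff_curvePolynomial (d := d) (WithLp.toLp 2 fun j => p.coeff (j + 1)) (p.coeff 0)
        ⟨k - 1, by omega⟩
      simp only [show k - 1 + 1 = k by omega] at this
      exact this
    · rw [Polynomial.coeff_eq_zero_of_natDegree_lt
        ((natDegree_curvePolynomial _ _).trans_lt (by omega)),
        Polynomial.coeff_eq_zero_of_natDegree_lt (by omega)]

lemma polynomial_eq_zero_of_card {t : Fin n → ℝ} (ht : StrictMono t) {p : Polynomial ℝ}
    (hp : p.natDegree ≤ d) {S : Finset (Fin n)} (hS : d < S.card)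
    (h : ∀ i ∈ S, p.eval (t i) = 0) : p = 0 := by
  refine Polynomial.eq_zero_of_natDegree_lt_card_of_eval_eq_zero' p (S.image t) ?_ ?_
  · intro x hx
    obtain ⟨i, hi, rfl⟩ := Finset.mem_image.1 hx
    exact h i hi
  · rw [Finset.card_image_of_injective _ ht.injective]; omega

/-- Each index of `S` above `j` contributes one negative factor. -/
lemma neg_one_pow_mul_prod_pos {t : Fin n → ℝ} (ht : StrictMono t) {S : Finset (Fin n)}
    {j : Fin n} (hj : j ∉ S) :
    0 < (-1 : ℝ) ^ (S.filter (j < ·)).card * ∏ i ∈ S, (t j - t i) := by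
  rw [← Finset.prod_const, Finset.prod_filter, ← Finset.prod_mul_distrib]
  refine Finset.prod_pos fun i hi => ?_
  have hne : i ≠ j := fun h => hj (h ▸ hi)
  rcases hne.lt_or_gt with h | h
  · rw [if_neg h.not_gt, one_mul]
    exact sub_pos.2 (ht h)
  · rw [if_pos h]
    have := ht h
    linarith

lemma card_filter_lt_add_card_filter_gt {S : Finset (Fin n)} {j : Fin n} (hj : j ∉ S) :
    (S.filter (· < j)).card + (S.filter (j < ·)).card = S.card := by
  rw [← Finset.card_filter_add_card_filter_not (s := S) (· < j)]
  congr 2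
  refine Finset.filter_congr fun i hi => ?_
  have hne : i ≠ j := fun h => hj (h ▸ hi)
  rw [not_lt]
  exact ⟨le_of_lt, fun h => lt_of_le_of_ne h hne.symm⟩

variable {t : Fin n → ℝ} {c : EuclideanSpace ℝ (Fin d)}

lemma polarDual_cyclicPolytope :
    polarDual (cyclicPolytope d t) c = polyhedron fun i => momentCurve d (t i) - c := by
  ext y
  constructor
  · exact fun h i => h _ (subset_convexHull ℝ _ ⟨i, rfl⟩)
  · intro h x hx
    have hconv : Convex ℝ {x : EuclideanSpace ℝ (Fin d) | inner ℝ (x - c) y ≤ 1} := by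
      intro x hx z hz u v hu hv huv
      have hx : inner ℝ (x - c) y ≤ 1 := hx
      have hz : inner ℝ (z - c) y ≤ 1 := hz
      change inner ℝ (u • x + v • z - c) y ≤ 1
      rw [inner_sub_left] at hx hz ⊢
      rw [inner_add_left, real_inner_smul_left, real_inner_smul_left]
      have : inner ℝ c y = u * inner ℝ c y + v * inner ℝ c y := by rw [← add_mul, huv, one_mul]
      nlinarith
    refine convexHull_min ?_ hconv hx
    rintro _ ⟨i, rfl⟩
    exact h i

lemma inner_sub_eq_eval (y : EuclideanSpace ℝ (Fin d)) (i : Fin n) :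
    inner ℝ (momentCurve d (t i) - c) y - 1 =
      (curvePolynomial y (-(inner ℝ c y + 1))).eval (t i) := by
  rw [eval_curvePolynomial, inner_sub_left]; ring

/-- More than `d` roots would make the polynomial vanish; then `y = 0`, but the constant coefficient
is `-1` in that case. -/
lemma card_activeSet_le (ht : StrictMono t) (y : EuclideanSpace ℝ (Fin d)) :
    (activeSet (fun i => momentCurve d (t i) - c) y).card ≤ d := by
  by_contra! hlt
  have h := polynomial_eq_zero_of_card ht
    (natDegree_curvePolynomial y (-(inner ℝ c y + 1))) hlt fun i hi => by
      rw [← inner_sub_eq_eval, mem_activeSet.1 hi, sub_self]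
  have hy : y = 0 := by
    ext j
    rw [← coeff_curvePolynomial y (-(inner ℝ c y + 1)) j, h]
    simp
  have h0 := coeff_zero_curvePolynomial y (-(inner ℝ c y + 1))
  rw [h, hy, inner_zero_right, Polynomial.coeff_zero] at h0
  norm_num at h0

/-- A ball around `c` inside the cyclic polytope lets one test `y` against a multiple of itself. -/
lemma isBounded_polyhedron (hc : c ∈ interior (cyclicPolytope d t)) :
    Bornology.IsBounded (polyhedron fun i => momentCurve d (t i) - c) := by
  obtain ⟨r, hr, hball⟩ := Metric.mem_nhds_iff.1 (mem_interior_iff_mem_nhds.1 hc)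
  rw [isBounded_iff_forall_norm_le]
  refine ⟨2 / r, fun y hy => ?_⟩
  rw [← polarDual_cyclicPolytope] at hy
  by_cases h0 : y = 0
  · rw [h0, norm_zero]; positivity
  have hpos : 0 < ‖y‖ := norm_pos_iff.2 h0
  have hmem : c + (r / 2 / ‖y‖) • y ∈ Metric.ball c r := by
    rw [mem_ball_iff_norm, add_sub_cancel_left, norm_smul, Real.norm_of_nonneg (by positivity),
      div_mul_cancel₀ _ hpos.ne']
    linarith
  have h1 := hy _ (hball hmem)
  rw [add_sub_cancel_left, real_inner_smul_left, real_inner_self_eq_norm_sq] at h1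
  have h2 : r / 2 / ‖y‖ * ‖y‖ ^ 2 = r / 2 * ‖y‖ := by field_simp
  rw [h2] at h1
  rw [le_div_iff₀ hr]; linarith

lemma isSimpleSystem_momentCurve (hn : d + 1 ≤ n) (ht : StrictMono t)
    (hc : c ∈ interior (cyclicPolytope d t)) :
    IsSimpleSystem d fun i => momentCurve d (t i) - c where
  finrank_eq := by simp
  isBounded := isBounded_polyhedron hc
  card_le y _ := card_activeSet_le ht y
  eq_zero y _ hyc w hw := by
    set a : Fin n → EuclideanSpace ℝ (Fin d) := fun i => momentCurve d (t i) - c with ha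
    obtain ⟨j, hj⟩ : ∃ j, j ∉ activeSet a y := by
      by_contra! h
      have := Finset.eq_univ_of_forall h
      rw [this, Finset.card_univ, Fintype.card_fin] at hyc
      omega
    have hcard : (insert j (activeSet a y)).card = d + 1 := by
      rw [Finset.card_insert_of_notMem hj, hyc]
    -- If `a j` is also orthogonal to `w`, a polynomial of degree at most `d` has `d + 1` roots. If
    -- not, moving from `y` along `w` makes `j` active as well, giving `d + 1` equalities at one
    -- point.
    by_cases hμ : inner ℝ (a j) w = 0
    · have h := polynomial_eq_zero_of_card ht (natDegree_curvePolynomial w (-inner ℝ c w))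
        (S := insert j (activeSet a y)) (by omega) fun i hi => by
          have h0 : inner ℝ (a i) w = 0 := by
            rcases Finset.mem_insert.1 hi with rfl | hi
            exacts [hμ, hw i hi]
          rw [ha, inner_sub_left] at h0
          rw [eval_curvePolynomial]; linarith
      ext k
      rw [← coeff_curvePolynomial w (-inner ℝ c w) k, h]
      simp
    · exfalso
      set m : ℝ := (1 - inner ℝ (a j) y) / inner ℝ (a j) w
      have hsub : insert j (activeSet a y) ⊆ activeSet a (y + m • w) := fun i hi => by
        rw [mem_activeSet, inner_add_right, real_inner_smul_right]
        rcases Finset.mem_insert.1 hi with rfl | hi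
        · rw [div_mul_cancel₀ _ hμ]; ring
        · rw [hw i hi, mem_activeSet.1 hi]; ring
      have h1 := Finset.card_le_card hsub
      have h2 : (activeSet a (y + m • w)).card ≤ d := card_activeSet_le ht _
      omega

lemma natDegree_C_mul_prod_le (r : ℝ) (S : Finset (Fin n)) :
    (Polynomial.C r * ∏ i ∈ S, (Polynomial.X - Polynomial.C (t i))).natDegree ≤ S.card := by
  refine (Polynomial.natDegree_C_mul_le _ _).trans ((Polynomial.natDegree_prod_le _ _).trans ?_)
  simp

lemma isGale_activeSet (hn : d + 1 ≤ n) (ht : StrictMono t) {y : EuclideanSpace ℝ (Fin d)}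
    (hy : y ∈ polyhedron fun i => momentCurve d (t i) - c)
    (hyc : (activeSet (fun i => momentCurve d (t i) - c) y).card = d) :
    IsGale (activeSet (fun i => momentCurve d (t i) - c) y) := by
  set a : Fin n → EuclideanSpace ℝ (Fin d) := fun i => momentCurve d (t i) - c with ha
  set S := activeSet a y with hS
  obtain ⟨j₀, hj₀⟩ : ∃ j, j ∉ S := by
    by_contra! h
    have := Finset.eq_univ_of_forall h
    rw [this, Finset.card_univ, Fintype.card_fin] at hyc
    omega
  have hprod : ∀ j ∉ S, ∏ i ∈ S, (t j - t i) ≠ 0 := fun j hj h => by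
    have := neg_one_pow_mul_prod_pos ht hj
    rw [h, mul_zero] at this
    exact this.false
  -- The slack polynomial vanishes at the `d` active parameters, so it is a multiple of their root
  -- product; `r` is chosen to match at one further parameter.
  set r : ℝ := (inner ℝ (a j₀) y - 1) / ∏ i ∈ S, (t j₀ - t i) with hr
  have heval : ∀ j, (Polynomial.C r * ∏ i ∈ S, (Polynomial.X - Polynomial.C (t i))).eval (t j)
      = r * ∏ i ∈ S, (t j - t i) := fun j => by
    simp [Polynomial.eval_prod]
  have hpoly := polynomial_eq_zero_of_card ht (d := d) (S := insert j₀ S)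
    (p := curvePolynomial y (-(inner ℝ c y + 1)) -
      Polynomial.C r * ∏ i ∈ S, (Polynomial.X - Polynomial.C (t i)))
    ((Polynomial.natDegree_sub_le _ _).trans (max_le (natDegree_curvePolynomial _ _)
      ((natDegree_C_mul_prod_le r S).trans hyc.le)))
    (by rw [Finset.card_insert_of_notMem hj₀, hyc]; omega)
    (fun i hi => by
      rw [Polynomial.eval_sub, ← inner_sub_eq_eval, heval]
      rcases Finset.mem_insert.1 hi with rfl | hi
      · rw [hr, div_mul_cancel₀ _ (hprod _ hj₀), sub_self]
      · have := mem_activeSet.1 hi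
        rw [ha] at this
        rw [this, Finset.prod_eq_zero hi (sub_self _)]; ring)
  have hval : ∀ j, inner ℝ (a j) y - 1 = r * ∏ i ∈ S, (t j - t i) := fun j => by
    rw [← heval, ← sub_eq_zero.1 hpoly, ← inner_sub_eq_eval]
  have hsign : ∀ j ∉ S, (-1 : ℝ) ^ (S.filter (j < ·)).card * r < 0 := fun j hj => by
    have h1 : inner ℝ (a j) y - 1 < 0 :=
      sub_neg.2 (lt_of_le_of_ne (hy j) fun h => hj (mem_activeSet.2 h))
    rw [hval] at h1
    have h2 := neg_one_pow_mul_prod_pos ht hj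
    rcases neg_one_pow_eq_or ℝ (S.filter (j < ·)).card with h | h
    · rw [h] at h2 ⊢
      by_contra! h3
      nlinarith
    · rw [h] at h2 ⊢
      by_contra! h3
      nlinarith
  refine ⟨if r < 0 then d % 2 else (d + 1) % 2, fun j hj => ?_⟩
  have h1 := hsign j hj
  have h2 := card_filter_lt_add_card_filter_gt hj
  rw [hyc] at h2
  rcases Nat.even_or_odd (S.filter (j < ·)).card with h | h
  · rw [h.neg_one_pow, one_mul] at h1
    rw [if_pos h1]
    obtain ⟨k, hk⟩ := h
    omega
  · rw [h.neg_one_pow] at h1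
    rw [if_neg (by linarith)]
    obtain ⟨k, hk⟩ := h
    omega

/-- By Gale's condition the root product of `S` has constant sign at the other parameters. This
yields a supporting hyperplane of the cyclic polytope, and rescaling its normal relative to `c`
gives the vertex of the polar dual. -/
lemma IsCyclicFacet.exists_activeSet_eq (hd : 1 ≤ d) (hn : d + 1 ≤ n) (ht : StrictMono t)
    (hc : c ∈ interior (cyclicPolytope d t)) {S : Finset (Fin n)} (hS : IsCyclicFacet d S) :
    ∃ y ∈ polyhedron (fun i => momentCurve d (t i) - c),
      activeSet (fun i => momentCurve d (t i) - c) y = S := by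
  obtain ⟨hcard, e, he⟩ := hS
  -- Off `S` the number of elements above has the parity of `e + d`, so this sign makes the
  -- polynomial negative there.
  set σ : ℝ := if (e + d) % 2 = 0 then -1 else 1 with hσ
  obtain ⟨y, b, hyb⟩ := exists_curvePolynomial_eq (d := d)
    (p := Polynomial.C σ * ∏ i ∈ S, (Polynomial.X - Polynomial.C (t i)))
    ((natDegree_C_mul_prod_le σ S).trans hcard.le)
  have hval : ∀ j, inner ℝ (momentCurve d (t j)) y + b = σ * ∏ i ∈ S, (t j - t i) := fun j => by
    rw [← eval_curvePolynomial, hyb]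
    simp [Polynomial.eval_prod]
  have hzero : ∀ j ∈ S, inner ℝ (momentCurve d (t j)) y + b = 0 := fun j hj => by
    rw [hval, Finset.prod_eq_zero hj (sub_self _), mul_zero]
  have hneg : ∀ j ∉ S, inner ℝ (momentCurve d (t j)) y + b < 0 := fun j hj => by
    rw [hval]
    have h1 := neg_one_pow_mul_prod_pos ht hj
    have h2 := card_filter_lt_add_card_filter_gt hj
    have h3 := he j hj
    rw [hcard] at h2
    rcases Nat.even_or_odd (S.filter (j < ·)).card with h | h
    · rw [h.neg_one_pow] at h1
      obtain ⟨k, hk⟩ := h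
      rw [hσ, if_pos (by omega)]; linarith
    · rw [h.neg_one_pow] at h1
      obtain ⟨k, hk⟩ := h
      rw [hσ, if_neg (by omega)]; linarith
  have hle : ∀ j, inner ℝ (momentCurve d (t j)) y + b ≤ 0 := fun j => by
    by_cases hj : j ∈ S
    exacts [(hzero j hj).le, (hneg j hj).le]
  have hy0 : y ≠ 0 := by
    rintro rfl
    obtain ⟨i, hi⟩ : S.Nonempty := Finset.card_pos.1 (by omega)
    obtain ⟨j, hj⟩ : ∃ j, j ∉ S := by
      by_contra! h
      have := Finset.eq_univ_of_forall h
      rw [this, Finset.card_univ, Fintype.card_fin] at hcard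
      omega
    have h1 := hzero i hi
    have h2 := hneg j hj
    rw [inner_zero_right] at h1 h2
    linarith
  have hhull : ∀ x ∈ cyclicPolytope d t, inner ℝ x y + b ≤ 0 := by
    intro x hx
    have hconv : Convex ℝ {x : EuclideanSpace ℝ (Fin d) | inner ℝ x y + b ≤ 0} := by
      intro x hx z hz u v hu hv huv
      have hx : inner ℝ x y + b ≤ 0 := hx
      have hz : inner ℝ z y + b ≤ 0 := hz
      change inner ℝ (u • x + v • z) y + b ≤ 0
      rw [inner_add_left, real_inner_smul_left, real_inner_smul_left]
      have : b = u * b + v * b := by rw [← add_mul, huv, one_mul]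
      nlinarith
    refine convexHull_min ?_ hconv hx
    rintro _ ⟨i, rfl⟩
    exact hle i
  -- An interior point satisfies the inequality strictly: a short step from `c` along `y` stays in
  -- the polytope and increases the functional.
  have hL : inner ℝ c y + b < 0 := by
    have hmem := mem_interior_iff_mem_nhds.1 hc
    have htend : Tendsto (fun δ : ℝ => c + δ • y) (𝓝[>] 0) (𝓝 c) := by
      have : Tendsto (fun δ : ℝ => c + δ • y) (𝓝 0) (𝓝 (c + (0 : ℝ) • y)) :=
        Continuous.tendsto (by fun_prop) 0
      rw [zero_smul, add_zero] at this
      exact this.mono_left nhdsWithin_le_nhds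
    obtain ⟨δ, h1, hδ⟩ := ((htend.eventually hmem).and self_mem_nhdsWithin).exists
    have hδ : 0 < δ := hδ
    have h2 := hhull _ h1
    rw [inner_add_left, real_inner_smul_left] at h2
    have h3 : 0 < inner ℝ y y := real_inner_self_pos.2 hy0
    nlinarith
  set L : ℝ := inner ℝ c y + b with hLdef
  have hinner : ∀ j, inner ℝ (momentCurve d (t j) - c) ((-L)⁻¹ • y) =
      1 + (-L)⁻¹ * (inner ℝ (momentCurve d (t j)) y + b) := fun j => by
    rw [real_inner_smul_right, inner_sub_left]
    have h := inv_mul_cancel₀ (show -L ≠ 0 by linarith)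
    linear_combination h + (-L)⁻¹ * hLdef
  have hLpos : 0 < (-L)⁻¹ := inv_pos.2 (by linarith)
  refine ⟨(-L)⁻¹ • y, fun j => ?_, ?_⟩
  · rw [hinner]
    have := mul_nonpos_of_nonneg_of_nonpos hLpos.le (hle j)
    linarith
  · ext j
    rw [mem_activeSet, hinner]
    constructor
    · intro h
      by_contra hj
      have := mul_neg_of_pos_of_neg hLpos (hneg j hj)
      linarith
    · intro hj
      rw [hzero j hj]; ring

end MomentCurve

theorem mainTheorem2 (d n : ℕ) (hd : 1 ≤ d) (hn : d + 1 ≤ n)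
    (t : Fin n → ℝ) (ht : StrictMono t)
    (c : EuclideanSpace ℝ (Fin d)) (hc : c ∈ interior (cyclicPolytope d t)) :
    SatisfiesPerlesConjecture d (polarDual (cyclicPolytope d t) c) := by
  rw [polarDual_cyclicPolytope]
  refine (isSimpleSystem_momentCurve hn ht hc).satisfiesPerlesConjecture hd hn fun S => ?_
  constructor
  · intro hS
    obtain ⟨y, hy, rfl⟩ := hS.exists_activeSet_eq hd hn ht hc
    exact ⟨y, hy, hS.1, rfl⟩
  · rintro ⟨y, hy, hyc, rfl⟩
    exact ⟨hyc, isGale_activeSet hn ht hy hyc⟩
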